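/- **Theorem (regret of an arbitrary algorithm with closed-form beliefs).** Let $\Pi$ (decisions) and $\mathcal O$ (observations) be measurable spaces, where $\Pi$ is countable or the $\sigma$-algebra of $\mathcal O$ is countably generated. Let $\mathcal M$ be a finite class of models; each model $M\in\mathcal M$ is a Markov kernel $\pi\mapsto M(\pi)$ from $\Pi$ to probability measures on $\mathcal O$ and comes with a measurable mean reward function $f_M:\Pi\to[0,1]$ and a maximizer $\pi_M\in\arg\max_{\pi\in\Pi}f_M(\pi)$. Let $M^*\in\mathcal M$ be the true model. An algorithm is a sequence of probability kernels that map the history $(\pi_s,o_s)_{s<t}$ to a distribution $p_t$ on $\Pi$; at round $t$ one draws $\pi_t\sim p_t$ and then $o_t\sim M^*(\pi_t)$. Its regret is $$\mathrm{Reg}_T=\sup_{\pi^*\in\Pi}\mathbb E\Big[\sum_{t=1}^T f_{M^*}(\pi^*)-\sum_{t=1}^T f_{M^*}(\pi_t)\Big].$$ For a distribution $\rho$ on $\mathcal M$ put $\rho_{o|\pi}=\mathbb E_{M\sim\rho}[M(\pi)]$, and let $D_{\mathrm H}^2(P,Q)=\int(\sqrt{dP}-\sqrt{dQ})^2$. Given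 $\eta>0$, let $\rho_1$ be the uniform distribution on $\mathcal M$ and, for $t\ge 1$, $$\mu_t(M)\propto\rho_t(M)\exp\Big(\eta\big(f_M(\pi_M)-\mathbb E_{\pi\sim p_t}[f_M(\pi)]\big)-\tfrac13\,\mathbb E_{\pi\sim p_t}\big[D_{\mathrm H}^2(M(\pi),(\rho_t)_{o|\pi})\big]\Big),\qquad \rho_{t+1}(M)=\mu_t(M\mid\pi_t,o_t),$$ where $\mu_t(\cdot\mid\pi_t,o_t)$ is the Bayesian posterior, $\mu_t(M\mid\pi,o)\propto\mu_t(M)\,[M(\pi)](o)$, and $[M(\pi)](\cdot)$ is a density of $M(\pi)$, jointly measurable in $(\pi,o)$, with respect to $\sum_{M'\in\mathcal M}M'(\pi)$. Then for every algorithm, every $\eta>0$, every $M^*\in\mathcal M$ and every $T\in\mathbb N$, $$\mathrm{Reg}_T\le\frac{\log|\mathcal M|}{\eta}+\mathbb E\Big[\sum_{t=1}^T\mathbb E_{M\sim\mu_t,\,\pi\sim p_t}\Big[f_M(\pi_M)-f_M(\pi)-\frac1{3\eta}D_{\mathrm H}^2\big(M(\pi),(\rho_t)_{o|\pi}\big)-\frac1{3\eta}\mathrm{KL}(\mu_t,\rho_t)\Big]\Big].$$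 -/

import Mathlib

open MeasureTheory ProbabilityTheory InformationTheory
open scoped ENNReal

namespace DMSO

noncomputable section

/-- The squared Hellinger distance `∫ (√dP - √dQ)²`, with both densities taken with respect to the
dominating measure `P + Q`. -/
def hellingerSq {O : Type*} [MeasurableSpace O] (P Q : Measure O) : ℝ :=
  ∫ o, (√(P.rnDeriv (P + Q) o).toReal - √(Q.rnDeriv (P + Q) o).toReal) ^ 2 ∂(P + Q)

/-- An admissible algorithm with decisions in `D` and observations in `O`: the `t`-th map (rounds
are numbered from `0`) sends the past decisions and observations to a probability measure `p_t`
over decisions. -/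
structure Algorithm (D O : Type*) [MeasurableSpace D] [MeasurableSpace O] where
  /-- The law of the next decision given the `t` past (decision, observation) pairs. -/
  policy : (t : ℕ) → Kernel (Fin t → D × O) D
  /-- The policy takes values in probability measures. -/
  markov : ∀ t, IsMarkovKernel (policy t)

/-- The law of the history `(π_0, o_0), …, (π_{t-1}, o_{t-1})` when at each round `π_s ∼ p_s` is
drawn by the algorithm and then `o_s ∼ env π_s` by the (stochastic) environment. -/
def historyLaw {D O : Type*} [MeasurableSpace D] [MeasurableSpace O]
    (alg : Algorithm D O) (env : Kernel D O) : (t : ℕ) → Measure (Fin t → D × O)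
  | 0 => Measure.dirac Fin.elim0
  | t + 1 =>
      (historyLaw alg env t ⊗ₘ (alg.policy t ⊗ₖ Kernel.prodMkLeft (Fin t → D × O) env)).map
        (fun x => Fin.snoc (α := fun _ => D × O) x.1 x.2)

/-- The frequentist regret `sup_{π*} E[∑_{t<T} f(π*) - ∑_{t<T} f(π_t)]` of the algorithm after `T`
rounds in the stochastic environment `env` with mean reward function `f`. -/
def regret {D O : Type*} [MeasurableSpace D] [MeasurableSpace O]
    (alg : Algorithm D O) (env : Kernel D O) (f : D → ℝ) (T : ℕ) : ℝ :=
  ⨆ πstar : D, ∫ h, (∑ _t : Fin T, f πstar - ∑ t : Fin T, f (h t).1) ∂(historyLaw alg env T)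

section Beliefs

variable {𝓜 D O : Type*} [MeasurableSpace 𝓜] [MeasurableSpace D] [MeasurableSpace O]

/-- The distribution `ρ_{o|π} = E_{M ∼ ρ}[M(π)]` of the observation induced by the belief `ρ` over
models. -/
def inducedObs (M : 𝓜 → Kernel D O) (ρ : Measure 𝓜) (π : D) : Measure O :=
  ρ.bind (fun m => M m π)

/-- The exponent `η (f_M(π_M) - E_{π ∼ p} f_M(π)) - (1/3) E_{π ∼ p} D_H²(M(π), ρ_{o|π})`. -/
def beliefExponent (M : 𝓜 → Kernel D O) (f : 𝓜 → D → ℝ) (opt : 𝓜 → D) (η : ℝ)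
    (p : Measure D) (ρ : Measure 𝓜) (m : 𝓜) : ℝ :=
  η * (f m (opt m) - ∫ π, f m π ∂p)
    - 1 / 3 * ∫ π, hellingerSq (M m π) (inducedObs M ρ π) ∂p

/-- The closed-form belief: the probability measure `μ ∝ ρ · exp (beliefExponent)`. -/
def closedFormBelief (M : 𝓜 → Kernel D O) (f : 𝓜 → D → ℝ) (opt : 𝓜 → D) (η : ℝ)
    (p : Measure D) (ρ : Measure 𝓜) : Measure 𝓜 :=
  ρ.tilted (beliefExponent M f opt η p ρ)

variable [Fintype 𝓜] [MeasurableSpace.CountableOrCountablyGenerated D O]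

/-- The likelihood `[M(π)](o)`: the density of `M(π)` with respect to the measure
`∑ M', M'(π)`, which dominates all the models; it is jointly measurable in `(π, o)`.
The posterior does not depend on the choice of the dominating measure. -/
def likelihood (M : 𝓜 → Kernel D O) (m : 𝓜) (π : D) (o : O) : ℝ≥0∞ :=
  Kernel.rnDeriv (M m) (∑ m', M m') π o

/-- The Bayesian posterior `μ(· | π, o)`, i.e. `μ(M | π, o) ∝ μ(M) · [M(π)](o)`. (When the
normalizer vanishes, which has probability zero for `o ∼ μ_{o|π}`, it is the zero measure.) -/
def posteriorBelief (M : 𝓜 → Kernel D O) (μ : Measure 𝓜) (π : D) (o : O) : Measure 𝓜 :=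
  (∫⁻ m, likelihood M m π o ∂μ)⁻¹ • μ.withDensity (fun m => likelihood M m π o)

/-- The reference distribution `ρ_t` as a function of the history before round `t`: `ρ_0` is
uniform and `ρ_{t+1} = μ_t(· | π_t, o_t)`, where `μ_t` is the closed-form belief built from `ρ_t`
and `p_t`. -/
def refBelief (M : 𝓜 → Kernel D O) (f : 𝓜 → D → ℝ) (opt : 𝓜 → D) (η : ℝ)
    (alg : Algorithm D O) : (t : ℕ) → (Fin t → D × O) → Measure 𝓜
  | 0, _ => uniformOn Set.univ
  | t + 1, h =>
      posteriorBelief M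
        (closedFormBelief M f opt η (alg.policy t (Fin.init h))
          (refBelief M f opt η alg t (Fin.init h)))
        (h (Fin.last t)).1 (h (Fin.last t)).2

/-- The algorithmic belief `μ_t` as a function of the history before round `t`. -/
def algBelief (M : 𝓜 → Kernel D O) (f : 𝓜 → D → ℝ) (opt : 𝓜 → D) (η : ℝ)
    (alg : Algorithm D O) (t : ℕ) (h : Fin t → D × O) : Measure 𝓜 :=
  closedFormBelief M f opt η (alg.policy t h) (refBelief M f opt η alg t h)

end Beliefs

end

end DMSO

/-! The potential is the expected value of `-log ρ_t(M*)`. It starts at `log |𝓜|` because the prior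
is uniform, and it stays nonnegative. Each round must therefore lower it by `η` times the expected
gap of the true model, up to an error of `η` times that round's term in the bound.

Write `E` for the exponent, `L` for the log-normalizer, `K` for `KL(μ_t, ρ_t)` and `H(ν)` for the
`p_t`-mean squared Hellinger distance from `M*` to the mixture under `ν`. Tilting changes `-log
ρ_t(M*)` by `L - E(M*) = L - η·gap + H(ρ_t)/3`. Conditioning on data drawn from `M*` then changes
it, on average, by at most `-H(μ_t)`: it adds `2 log r`, where `r` is the square root of the
likelihood ratio of mixture to truth, `log r ≤ r - 1`, and the conditional mean of `r` is `1 -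
H(μ_t)/2` (`ae_weights_posteriorBelief`, `integral_bayesRatio`).

The two Hellinger terms refer to different mixtures. `hellMix_le_two_mul` and
`sum_sq_sqrt_sub_sqrt_le` give `H(ρ_t) ≤ 2 H(μ_t) + 2 K`, so the total error is at most `L + 2K/3`.
By `roundTerm_eq` this is exactly `η` times the round's term. `neg_log_weights_closedFormBelief_le`
is the resulting one-step inequality, and `regret_add_integral_neg_log_le` telescopes it. -/

namespace DMSO

noncomputable section

/-! ### Inequalities for the squared Hellinger distance -/

/-- The squared Hellinger distance can be computed with densities with respect to any common
dominating measure. -/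
lemma hellingerSq_withDensity {O : Type*} [MeasurableSpace O] {ν : Measure O} [SigmaFinite ν]
    {p q : O → ℝ≥0∞} (hp : Measurable p) (hq : Measurable q)
    [IsFiniteMeasure (ν.withDensity p)] [IsFiniteMeasure (ν.withDensity q)] :
    hellingerSq (ν.withDensity p) (ν.withDensity q) =
      ∫ o, (√(p o).toReal - √(q o).toReal) ^ 2 ∂ν := by
  have hpfin : ∀ᵐ o ∂ν, p o < ∞ := by
    refine ae_lt_top hp ?_
    have := measure_lt_top (ν.withDensity p) Set.univ
    rw [withDensity_apply _ MeasurableSet.univ, setLIntegral_univ] at this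
    exact this.ne
  have hqfin : ∀ᵐ o ∂ν, q o < ∞ := by
    refine ae_lt_top hq ?_
    have := measure_lt_top (ν.withDensity q) Set.univ
    rw [withDensity_apply _ MeasurableSet.univ, setLIntegral_univ] at this
    exact this.ne
  set P := ν.withDensity p with hP
  set Q := ν.withDensity q with hQ
  have hsum : P + Q = ν.withDensity (p + q) := (withDensity_add_left hp q).symm
  have hpq : Measurable (p + q) := hp.add hq
  -- Chain rule for densities: both sides are densities of `R` with respect to `ν`, hence equal
  -- almost everywhere.
  have key : ∀ (R : Measure O) (r : O → ℝ≥0∞), R = ν.withDensity r → Measurable r →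
      SigmaFinite R → R ≪ P + Q → ∀ᵐ o ∂ν, R.rnDeriv (P + Q) o * (p + q) o = r o := by
    intro R r hR hr _ hac
    have h1 : (P + Q).withDensity (R.rnDeriv (P + Q)) = R := Measure.withDensity_rnDeriv_eq _ _ hac
    rw [hsum, ← withDensity_mul _ hpq (Measure.measurable_rnDeriv _ _)] at h1
    have h2 := (withDensity_eq_iff_of_sigmaFinite
      (hpq.mul (Measure.measurable_rnDeriv _ _)).aemeasurable hr.aemeasurable).1 (h1.trans hR)
    filter_upwards [h2] with o ho
    rw [← ho, hsum]
    simp [mul_comm]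
  have kP := key P p hP hp inferInstance (Measure.AbsolutelyContinuous.rfl.add_right Q)
  have kQ := key Q q hQ hq inferInstance
    (by rw [add_comm]; exact Measure.AbsolutelyContinuous.rfl.add_right P)
  have hfin : ∀ᵐ o ∂ν, (p + q) o < ∞ := by
    filter_upwards [hpfin, hqfin] with o h1 h2 using ENNReal.add_lt_top.2 ⟨h1, h2⟩
  unfold hellingerSq
  conv_lhs => rw [hsum]
  rw [integral_withDensity_eq_integral_toReal_smul hpq hfin]
  refine integral_congr_ae ?_
  filter_upwards [kP, kQ] with o h1 h2
  rw [← h1, ← h2, ← hsum]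
  simp only [ENNReal.toReal_mul, smul_eq_mul]
  rw [Real.sqrt_mul ENNReal.toReal_nonneg, Real.sqrt_mul ENNReal.toReal_nonneg, ← sub_mul, mul_pow,
    Real.sq_sqrt ENNReal.toReal_nonneg, mul_comm]

/-- Minkowski's inequality for mixtures: the Hellinger integrand of two mixtures is at most the
mixture of the Hellinger terms of the weights. -/
lemma sq_sqrt_sum_sub_sqrt_sum_le {ι : Type*} (s : Finset ι) {v w x : ι → ℝ} (hv : ∀ i, 0 ≤ v i)
    (hw : ∀ i, 0 ≤ w i) (hx : ∀ i, 0 ≤ x i) :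
    (√(∑ i ∈ s, v i * x i) - √(∑ i ∈ s, w i * x i)) ^ 2 ≤ ∑ i ∈ s, (√(v i) - √(w i)) ^ 2 * x i := by
  have hvx : ∀ i, 0 ≤ v i * x i := fun i => mul_nonneg (hv i) (hx i)
  have hwx : ∀ i, 0 ≤ w i * x i := fun i => mul_nonneg (hw i) (hx i)
  -- Cauchy–Schwarz bounds the cross term; the diagonal terms of both sides agree.
  have h := Real.sum_sqrt_mul_sqrt_le s hvx hwx
  have e : ∑ i ∈ s, (√(v i) - √(w i)) ^ 2 * x i =
      ∑ i ∈ s, v i * x i + ∑ i ∈ s, w i * x i - 2 * ∑ i ∈ s, √(v i * x i) * √(w i * x i) := by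
    rw [Finset.mul_sum, ← Finset.sum_add_distrib, ← Finset.sum_sub_distrib]
    refine Finset.sum_congr rfl fun i _ => ?_
    rw [Real.sqrt_mul (hv i), Real.sqrt_mul (hw i), sub_sq, Real.sq_sqrt (hv i),
      Real.sq_sqrt (hw i)]
    linear_combination (2 * √(v i) * √(w i)) * Real.sq_sqrt (hx i)
  rw [e, sub_sq, Real.sq_sqrt (Finset.sum_nonneg fun i _ => hvx i),
    Real.sq_sqrt (Finset.sum_nonneg fun i _ => hwx i)]
  linarith

/-- The squared Hellinger distance between probability vectors is at most the relative entropy. -/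
lemma sum_sq_sqrt_sub_sqrt_le {ι : Type*} (s : Finset ι) {v w c : ι → ℝ} (hw : ∀ i, 0 ≤ w i)
    (hv : ∀ i, v i = w i * Real.exp (c i)) (hv1 : ∑ i ∈ s, v i = 1) (hw1 : ∑ i ∈ s, w i = 1) :
    ∑ i ∈ s, (√(v i) - √(w i)) ^ 2 ≤ ∑ i ∈ s, v i * c i := by
  -- The correction `w i - v i` sums to zero. With `x = exp (c i / 2)`, the termwise claim after
  -- division by a positive `w i` is `x² (1 - c i / 2) ≤ x`, that is, `1 - c i / 2 ≤ exp (-(c i /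
  -- 2))`.
  have h : ∀ i, (√(v i) - √(w i)) ^ 2 ≤ w i - v i + v i * c i := by
    intro i
    have e1 : Real.exp (c i) = Real.exp (c i / 2) ^ 2 := by
      rw [← Real.exp_nat_mul]; congr 1; push_cast; ring
    have hs : √(v i) = √(w i) * Real.exp (c i / 2) := by
      rw [hv, e1, Real.sqrt_mul (hw i), Real.sqrt_sq (Real.exp_pos _).le]
    have h2 := Real.add_one_le_exp (-(c i / 2))
    rw [Real.exp_neg] at h2
    have h3 : Real.exp (c i / 2) ^ 2 * (1 - c i / 2) ≤ Real.exp (c i / 2) := by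
      have := mul_le_mul_of_nonneg_left h2 (sq_nonneg (Real.exp (c i / 2)))
      have e := mul_inv_cancel₀ (Real.exp_pos (c i / 2)).ne'
      calc _ = Real.exp (c i / 2) ^ 2 * (-(c i / 2) + 1) := by ring
        _ ≤ _ := this
        _ = Real.exp (c i / 2) := by rw [sq, mul_assoc, e, mul_one]
    have h4 := mul_le_mul_of_nonneg_left h3 (hw i)
    rw [hs, hv, e1]
    have : (√(w i) * Real.exp (c i / 2) - √(w i)) ^ 2 =
        w i * (Real.exp (c i / 2) - 1) ^ 2 := by
      rw [← Real.sq_sqrt (hw i)]; simp only [Real.sqrt_sq (Real.sqrt_nonneg _)]; ring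
    rw [this]
    nlinarith
  calc _ ≤ ∑ i ∈ s, (w i - v i + v i * c i) := Finset.sum_le_sum fun i _ => h i
    _ = _ := by rw [Finset.sum_add_distrib, Finset.sum_sub_distrib, hv1, hw1]; ring

lemma integrable_sqrt_mul_sqrt {O : Type*} [MeasurableSpace O] {ν : Measure O} {a b : O → ℝ} (ha : Integrable a ν)
    (hb : Integrable b ν) (ha0 : ∀ o, 0 ≤ a o) (hb0 : ∀ o, 0 ≤ b o) :
    Integrable (fun o => √(a o) * √(b o)) ν := by
  refine (ha.add hb).mono' (ha.1.aemeasurable.sqrt.mul hb.1.aemeasurable.sqrt).aestronglyMeasurable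
    (Filter.Eventually.of_forall fun o => ?_)
  rw [Real.norm_of_nonneg (by positivity)]
  have := Real.sq_sqrt (ha0 o)
  have := Real.sq_sqrt (hb0 o)
  simp only [Pi.add_apply]
  nlinarith [sq_nonneg (√(a o) - √(b o)), Real.sqrt_nonneg (a o), Real.sqrt_nonneg (b o),
    mul_nonneg (Real.sqrt_nonneg (a o)) (Real.sqrt_nonneg (b o))]

lemma integrable_sq_sqrt_sub_sqrt {O : Type*} [MeasurableSpace O] {ν : Measure O} {a b : O → ℝ} (ha : Integrable a ν)
    (hb : Integrable b ν) (ha0 : ∀ o, 0 ≤ a o) (hb0 : ∀ o, 0 ≤ b o) :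
    Integrable (fun o => (√(a o) - √(b o)) ^ 2) ν := by
  have e : (fun o => (√(a o) - √(b o)) ^ 2) = fun o => a o + b o - 2 * (√(a o) * √(b o)) := by
    ext o; rw [sub_sq, Real.sq_sqrt (ha0 o), Real.sq_sqrt (hb0 o)]; ring
  rw [e]
  exact (ha.add hb).sub ((integrable_sqrt_mul_sqrt ha hb ha0 hb0).const_mul 2)

/-! ### Densities of the models and of their mixtures -/

section Likelihood

variable {𝓜 D O : Type*} [MeasurableSpace D] [MeasurableSpace O]
  [Fintype 𝓜] [MeasurableSpace.CountableOrCountablyGenerated D O]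

/-- The dominating kernel `∑ M', M'`. -/
abbrev dominating (M : 𝓜 → Kernel D O) : Kernel D O := ∑ m, M m

omit [MeasurableSpace.CountableOrCountablyGenerated D O] in
lemma isFiniteKernel_dominating (M : 𝓜 → Kernel D O) (hM : ∀ m, IsMarkovKernel (M m)) :
    IsFiniteKernel (dominating M) :=
  Finset.sum_induction _ IsFiniteKernel (fun _ _ _ _ => inferInstance) inferInstance
    fun m _ => have := hM m; inferInstance

/-- The real-valued likelihood. -/
def lik (M : 𝓜 → Kernel D O) (m : 𝓜) (π : D) (o : O) : ℝ := (likelihood M m π o).toReal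

/-- The density of the mixture of the models with weights `w`. -/
def mixLik (M : 𝓜 → Kernel D O) (w : 𝓜 → ℝ) (π : D) (o : O) : ℝ := ∑ m, w m * lik M m π o

/-- The squared Hellinger distance of the model `m` and the mixture with weights `w`, as an
integral with respect to the dominating kernel. -/
def hellMix (M : 𝓜 → Kernel D O) (m : 𝓜) (w : 𝓜 → ℝ) (π : D) : ℝ :=
  ∫ o, (√(lik M m π o) - √(mixLik M w π o)) ^ 2 ∂(dominating M π)

lemma measurable_likelihood (M : 𝓜 → Kernel D O) (m : 𝓜) :
    Measurable (fun x : D × O => likelihood M m x.1 x.2) := Kernel.measurable_rnDeriv _ _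

lemma measurable_likelihood_right (M : 𝓜 → Kernel D O) (m : 𝓜) (π : D) :
    Measurable (likelihood M m π) := (measurable_likelihood M m).comp measurable_prodMk_left

lemma measurable_lik (M : 𝓜 → Kernel D O) (m : 𝓜) :
    Measurable (fun x : D × O => lik M m x.1 x.2) := (measurable_likelihood M m).ennreal_toReal

lemma lik_nonneg (M : 𝓜 → Kernel D O) (m : 𝓜) (π : D) (o : O) : 0 ≤ lik M m π o :=
  ENNReal.toReal_nonneg

lemma measurable_mixLik (M : 𝓜 → Kernel D O) :
    Measurable (fun x : (𝓜 → ℝ) × D × O => mixLik M x.1 x.2.1 x.2.2) := by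
  unfold mixLik
  refine Finset.measurable_fun_sum _ fun m _ => ?_
  exact ((measurable_pi_apply m).comp measurable_fst).mul
    ((measurable_lik M m).comp measurable_snd)

lemma mixLik_nonneg (M : 𝓜 → Kernel D O) {w : 𝓜 → ℝ} (hw : ∀ m, 0 ≤ w m) (π : D) (o : O) :
    0 ≤ mixLik M w π o := Finset.sum_nonneg fun m _ => mul_nonneg (hw m) (lik_nonneg M m π o)

variable {M : 𝓜 → Kernel D O} (hM : ∀ m, IsMarkovKernel (M m))
include hM

lemma likelihood_lt_top (m : 𝓜) (π : D) : ∀ᵐ o ∂(dominating M π), likelihood M m π o < ∞ := by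
  have := isFiniteKernel_dominating M hM
  exact Kernel.rnDeriv_lt_top _ _

lemma withDensity_likelihood (m : 𝓜) (π : D) :
    (dominating M π).withDensity (likelihood M m π) = M m π := by
  have := isFiniteKernel_dominating M hM
  have h : (likelihood M m π) =ᵐ[dominating M π] (M m π).rnDeriv (dominating M π) :=
    Kernel.rnDeriv_eq_rnDeriv_measure
  rw [withDensity_congr_ae h]
  refine Measure.withDensity_rnDeriv_eq _ _ ?_
  refine Measure.absolutelyContinuous_of_le ?_
  intro s
  rw [Kernel.finsetSum_apply' ]
  exact Finset.single_le_sum (f := fun i => M i π s) (fun _ _ => zero_le) (Finset.mem_univ m)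

lemma lintegral_likelihood (m : 𝓜) (π : D) :
    ∫⁻ o, likelihood M m π o ∂(dominating M π) = 1 := by
  have := congrArg (fun μ => μ Set.univ) (withDensity_likelihood hM m π)
  simpa [withDensity_apply] using this

lemma integrable_lik (m : 𝓜) (π : D) : Integrable (lik M m π) (dominating M π) :=
  integrable_toReal_of_lintegral_ne_top
    (measurable_likelihood_right M m π).aemeasurable
    (by rw [lintegral_likelihood hM]; simp)

lemma integral_lik (m : 𝓜) (π : D) : ∫ o, lik M m π o ∂(dominating M π) = 1 := by
  unfold lik
  rw [integral_toReal (measurable_likelihood_right M m π).aemeasurable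
    (likelihood_lt_top hM m π), lintegral_likelihood hM]
  simp

lemma integrable_mixLik (w : 𝓜 → ℝ) (π : D) : Integrable (mixLik M w π) (dominating M π) :=
  integrable_finsetSum _ fun m _ => (integrable_lik hM m π).const_mul _

lemma integral_mixLik (w : 𝓜 → ℝ) (π : D) :
    ∫ o, mixLik M w π o ∂(dominating M π) = ∑ m, w m := by
  unfold mixLik
  rw [integral_finsetSum _ fun m _ => (integrable_lik hM m π).const_mul _]
  simp only [integral_const_mul, integral_lik hM, mul_one]

/-- Expanding the square isolates the Hellinger affinity, the quantity that the posterior update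
produces. -/
lemma hellMix_eq {w : 𝓜 → ℝ} (hw : ∀ m, 0 ≤ w m) (m : 𝓜) (π : D) :
    hellMix M m w π = 1 + ∑ m', w m' -
      2 * ∫ o, √(lik M m π o) * √(mixLik M w π o) ∂(dominating M π) := by
  have e : (fun o => (√(lik M m π o) - √(mixLik M w π o)) ^ 2) =
      fun o => lik M m π o + mixLik M w π o - 2 * (√(lik M m π o) * √(mixLik M w π o)) := by
    ext o
    rw [sub_sq, Real.sq_sqrt (lik_nonneg M m π o), Real.sq_sqrt (mixLik_nonneg M hw π o)]; ring
  unfold hellMix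
  rw [e, integral_sub (f := fun o => lik M m π o + mixLik M w π o)
    ((integrable_lik hM m π).add (integrable_mixLik hM w π))
    ((integrable_sqrt_mul_sqrt (integrable_lik hM m π) (integrable_mixLik hM w π)
      (lik_nonneg M m π) (mixLik_nonneg M hw π)).const_mul 2),
    integral_add (integrable_lik hM m π) (integrable_mixLik hM w π), integral_lik hM,
    integral_mixLik hM, integral_const_mul]

omit hM in
lemma hellMix_nonneg (M : 𝓜 → Kernel D O) (w : 𝓜 → ℝ) (m : 𝓜) (π : D) : 0 ≤ hellMix M m w π :=
  integral_nonneg fun _ => sq_nonneg _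

lemma hellMix_le {w : 𝓜 → ℝ} (hw : ∀ m, 0 ≤ w m) (m : 𝓜) (π : D) :
    hellMix M m w π ≤ 1 + ∑ m', w m' := by
  rw [hellMix_eq hM hw]
  have : 0 ≤ ∫ o, √(lik M m π o) * √(mixLik M w π o) ∂(dominating M π) :=
    integral_nonneg fun o => by positivity
  linarith

lemma measurable_hellMix (m : 𝓜) :
    Measurable (fun x : (𝓜 → ℝ) × D => hellMix M m x.1 x.2) := by
  have := isFiniteKernel_dominating M hM
  have h : Measurable (fun x : ((𝓜 → ℝ) × D) × O =>
      (√(lik M m x.1.2 x.2) - √(mixLik M x.1.1 x.1.2 x.2)) ^ 2) := by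
    refine (Measurable.sub ?_ ?_).pow_const 2
    · exact ((measurable_lik M m).comp
        ((measurable_snd.comp measurable_fst).prodMk measurable_snd)).sqrt
    · exact ((measurable_mixLik M).comp ((measurable_fst.comp measurable_fst).prodMk
        ((measurable_snd.comp measurable_fst).prodMk measurable_snd))).sqrt
  exact (h.stronglyMeasurable.integral_kernel_prod_right'
    (κ := Kernel.prodMkLeft (𝓜 → ℝ) (dominating M))).measurable

/-- Approximate triangle inequality for the distance of a model to two mixtures, combined with the
comparison of the mixtures through their weights. -/
lemma hellMix_le_two_mul {v w : 𝓜 → ℝ} (hv : ∀ m, 0 ≤ v m) (hw : ∀ m, 0 ≤ w m) (m : 𝓜) (π : D) :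
    hellMix M m w π ≤ 2 * hellMix M m v π + 2 * ∑ m', (√(v m') - √(w m')) ^ 2 := by
  have i1 := integrable_sq_sqrt_sub_sqrt (integrable_lik hM m π) (integrable_mixLik hM v π)
    (lik_nonneg M m π) (mixLik_nonneg M hv π)
  have i2 := integrable_mixLik hM (fun m' => (√(v m') - √(w m')) ^ 2) π
  calc hellMix M m w π ≤ ∫ o, (2 * (√(lik M m π o) - √(mixLik M v π o)) ^ 2 +
        2 * mixLik M (fun m' => (√(v m') - √(w m')) ^ 2) π o) ∂(dominating M π) := by
        refine integral_mono (integrable_sq_sqrt_sub_sqrt (integrable_lik hM m π)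
          (integrable_mixLik hM w π) (lik_nonneg M m π) (mixLik_nonneg M hw π))
          ((i1.const_mul 2).add (i2.const_mul 2)) fun o => ?_
        have := sq_sqrt_sum_sub_sqrt_sum_le Finset.univ hv hw (fun m' => lik_nonneg M m' π o)
        simp only [mixLik] at this ⊢
        -- This is `(a - c)² ≤ 2 (a - b)² + 2 (b - c)²` with `b`, `c` the roots of the two mixture
        -- densities; Minkowski has bounded `(b - c)²`.
        nlinarith [sq_nonneg ((√(lik M m π o) - √(∑ m, v m * lik M m π o)) -
          (√(∑ m, v m * lik M m π o) - √(∑ m, w m * lik M m π o)))]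
    _ = _ := by
        rw [integral_add (i1.const_mul 2) (i2.const_mul 2), integral_const_mul, integral_const_mul,
          integral_mixLik hM]
        rfl

end Likelihood

/-! ### Beliefs over finitely many models as weight vectors, and their tiltings -/

section RealWeights

variable {𝓜 : Type*} [Fintype 𝓜] [MeasurableSpace 𝓜] [MeasurableSingletonClass 𝓜]

/-- The weights of a belief over models, as real numbers. -/
def weights (ρ : Measure 𝓜) (m : 𝓜) : ℝ := ρ.real {m}

omit [Fintype 𝓜] [MeasurableSingletonClass 𝓜] in
lemma weights_nonneg (ρ : Measure 𝓜) (m : 𝓜) : 0 ≤ weights ρ m := measureReal_nonneg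

lemma sum_weights (ρ : Measure 𝓜) [IsFiniteMeasure ρ] : ∑ m, weights ρ m = ρ.real Set.univ := by
  unfold weights
  rw [sum_measureReal_singleton, Finset.coe_univ]

lemma sum_weights_le_one (ρ : Measure 𝓜) [IsZeroOrProbabilityMeasure ρ] :
    ∑ m, weights ρ m ≤ 1 := by
  rw [sum_weights]; exact measureReal_le_one

lemma integral_eq_sum_weights (ρ : Measure 𝓜) [IsFiniteMeasure ρ] (g : 𝓜 → ℝ) :
    ∫ m, g m ∂ρ = ∑ m, weights ρ m * g m := by
  rw [integral_fintype .of_finite]; rfl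

/-- Only finiteness is assumed, so the zero measure is covered: both sides are then `0`. -/
lemma weights_tilted (ρ : Measure 𝓜) [IsFiniteMeasure ρ] (E : 𝓜 → ℝ) (m : 𝓜) :
    weights (ρ.tilted E) m =
      weights ρ m * (Real.exp (E m) / ∑ m', weights ρ m' * Real.exp (E m')) := by
  have h0 : 0 ≤ ∑ m', weights ρ m' * Real.exp (E m') :=
    Finset.sum_nonneg fun m' _ => mul_nonneg (weights_nonneg ρ m') (Real.exp_pos _).le
  rw [weights, Measure.real, tilted_apply, lintegral_singleton, ENNReal.toReal_mul,
    ENNReal.toReal_ofReal (by rw [integral_eq_sum_weights]; positivity),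
    integral_eq_sum_weights, mul_comm]
  rfl

lemma sum_weights_mul_exp_pos (ρ : Measure 𝓜) [IsProbabilityMeasure ρ] (E : 𝓜 → ℝ) :
    0 < ∑ m, weights ρ m * Real.exp (E m) := by
  rw [← integral_eq_sum_weights]
  exact integral_exp_pos .of_finite

lemma weights_tilted_eq_mul_exp (ρ : Measure 𝓜) [IsProbabilityMeasure ρ] (E : 𝓜 → ℝ) (m : 𝓜) :
    weights (ρ.tilted E) m =
      weights ρ m * Real.exp (E m - Real.log (∑ m', weights ρ m' * Real.exp (E m'))) := by
  rw [weights_tilted, Real.exp_sub, Real.exp_log (sum_weights_mul_exp_pos ρ E)]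

instance isProbabilityMeasure_tilted_of_fintype (ρ : Measure 𝓜) [IsProbabilityMeasure ρ]
    (E : 𝓜 → ℝ) : IsProbabilityMeasure (ρ.tilted E) :=
  isProbabilityMeasure_tilted .of_finite

/-- The log-density of a tilting is its exponent minus the log-normalizer. -/
lemma toReal_klDiv_tilted (ρ : Measure 𝓜) [IsProbabilityMeasure ρ] (E : 𝓜 → ℝ) :
    (klDiv (ρ.tilted E) ρ).toReal = ∑ m, weights (ρ.tilted E) m *
      (E m - Real.log (∑ m', weights ρ m' * Real.exp (E m'))) := by
  rw [toReal_klDiv_of_measure_eq (tilted_absolutelyContinuous ρ E) (by simp),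
    ← integral_eq_sum_weights]
  refine integral_congr_ae ?_
  have h := log_rnDeriv_tilted_left_self (μ := ρ) (f := E) .of_finite
  filter_upwards [(tilted_absolutelyContinuous ρ E).ae_le h] with m hm
  rw [llr, hm, integral_eq_sum_weights]

/-- The normalizer is an average of exponentials, so its logarithm lies between the extreme
exponents. -/
lemma log_sum_weights_mul_exp_mem (ρ : Measure 𝓜) [IsProbabilityMeasure ρ] {E : 𝓜 → ℝ} {a b : ℝ}
    (hE : ∀ m, E m ∈ Set.Icc a b) :
    Real.log (∑ m, weights ρ m * Real.exp (E m)) ∈ Set.Icc a b := by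
  have h1 : ∑ m, weights ρ m = 1 := by rw [sum_weights]; simp
  constructor
  · rw [Real.le_log_iff_exp_le (sum_weights_mul_exp_pos ρ E)]
    calc Real.exp a = ∑ m, weights ρ m * Real.exp a := by rw [← Finset.sum_mul, h1, one_mul]
      _ ≤ _ := Finset.sum_le_sum fun m _ => mul_le_mul_of_nonneg_left
        (Real.exp_le_exp.2 (hE m).1) (weights_nonneg ρ m)
  · rw [Real.log_le_iff_le_exp (sum_weights_mul_exp_pos ρ E)]
    calc _ ≤ ∑ m, weights ρ m * Real.exp b := Finset.sum_le_sum fun m _ =>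
          mul_le_mul_of_nonneg_left (Real.exp_le_exp.2 (hE m).2) (weights_nonneg ρ m)
      _ = Real.exp b := by rw [← Finset.sum_mul, h1, one_mul]

end RealWeights

/-! ### One round: the closed-form belief and its term in the bound -/

section Round

variable {𝓜 D O : Type*} [Fintype 𝓜] [MeasurableSpace 𝓜] [MeasurableSingletonClass 𝓜]
  [MeasurableSpace D] [MeasurableSpace O] [MeasurableSpace.CountableOrCountablyGenerated D O]
  {M : 𝓜 → Kernel D O}

lemma inducedObs_eq_withDensity (hM : ∀ m, IsMarkovKernel (M m)) (ρ : Measure 𝓜) (π : D) :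
    inducedObs M ρ π =
      (dominating M π).withDensity (fun o => ∑ m, ρ {m} * likelihood M m π o) := by
  ext s hs
  rw [inducedObs, Measure.bind_apply hs Measurable.of_discrete.aemeasurable, lintegral_fintype,
    withDensity_apply _ hs,
    lintegral_finsetSum _ fun m _ => (measurable_likelihood_right M m π).const_mul _]
  refine Finset.sum_congr rfl fun m _ => ?_
  rw [lintegral_const_mul _ (measurable_likelihood_right M m π), ← withDensity_apply _ hs,
    withDensity_likelihood hM, mul_comm]

instance isFiniteMeasure_inducedObs (M : 𝓜 → Kernel D O) [hM : ∀ m, IsMarkovKernel (M m)]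
    (ρ : Measure 𝓜) [IsFiniteMeasure ρ] (π : D) : IsFiniteMeasure (inducedObs M ρ π) := by
  refine ⟨?_⟩
  rw [inducedObs, Measure.bind_apply MeasurableSet.univ Measurable.of_discrete.aemeasurable]
  simp

/-- The right side integrates against a fixed kernel and sees `ρ` only through its weights, which
makes measurability in the history accessible. -/
lemma hellingerSq_inducedObs (hM : ∀ m, IsMarkovKernel (M m)) (ρ : Measure 𝓜) [IsFiniteMeasure ρ]
    (m : 𝓜) (π : D) :
    hellingerSq (M m π) (inducedObs M ρ π) = hellMix M m (weights ρ) π := by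
  have := isFiniteKernel_dominating M hM
  have h1 := withDensity_likelihood hM m π
  have h2 := inducedObs_eq_withDensity hM ρ π
  have : IsFiniteMeasure ((dominating M π).withDensity (likelihood M m π)) := by
    rw [h1]; infer_instance
  have : IsFiniteMeasure
      ((dominating M π).withDensity (fun o => ∑ m, ρ {m} * likelihood M m π o)) := by
    rw [← h2]; infer_instance
  rw [h2, ← h1, hellingerSq_withDensity (measurable_likelihood_right M m π)
    (Finset.measurable_fun_sum _ fun m _ => (measurable_likelihood_right M m π).const_mul _)]
  refine integral_congr_ae ?_
  filter_upwards [ae_all_iff.2 fun m' => likelihood_lt_top hM m' π] with o ho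
  rw [ENNReal.toReal_sum fun m' _ => ENNReal.mul_ne_top (measure_ne_top _ _) (ho m').ne]
  simp only [ENNReal.toReal_mul]
  rfl

/-- The exponent of the closed-form belief in terms of the weights of the reference belief. -/
def exponent (M : 𝓜 → Kernel D O) (f : 𝓜 → D → ℝ) (opt : 𝓜 → D) (η : ℝ)
    (p : Measure D) (w : 𝓜 → ℝ) (m : 𝓜) : ℝ :=
  η * (f m (opt m) - ∫ π, f m π ∂p) - 1 / 3 * ∫ π, hellMix M m w π ∂p

variable (hM : ∀ m, IsMarkovKernel (M m)) {f : 𝓜 → D → ℝ} (hf : ∀ m, Measurable (f m))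
  (hf01 : ∀ m π, f m π ∈ Set.Icc (0 : ℝ) 1) {opt : 𝓜 → D} (hopt : ∀ m π, f m π ≤ f m (opt m))
  {η : ℝ} (hη : 0 < η)

include hM in
lemma beliefExponent_eq (f : 𝓜 → D → ℝ) (opt : 𝓜 → D) (η : ℝ) (p : Measure D) (ρ : Measure 𝓜)
    [IsFiniteMeasure ρ] :
    beliefExponent M f opt η p ρ = exponent M f opt η p (weights ρ) := by
  ext m
  simp only [beliefExponent, exponent, hellingerSq_inducedObs hM]

/-- The contribution of one round to the right-hand side of the regret bound. -/
def roundTerm (M : 𝓜 → Kernel D O) (f : 𝓜 → D → ℝ) (opt : 𝓜 → D) (η : ℝ)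
    (p : Measure D) (ρ : Measure 𝓜) : ℝ :=
  ∫ m, ∫ π, (f m (opt m) - f m π
    - 1 / (3 * η) * hellingerSq (M m π) (inducedObs M ρ π)
    - 1 / (3 * η) * (klDiv (closedFormBelief M f opt η p ρ) ρ).toReal) ∂p
    ∂(closedFormBelief M f opt η p ρ)

/-- The logarithm of the normalizer of the closed-form belief. -/
def logNormalizer (M : 𝓜 → Kernel D O) (f : 𝓜 → D → ℝ) (opt : 𝓜 → D) (η : ℝ)
    (p : Measure D) (w : 𝓜 → ℝ) : ℝ :=
  Real.log (∑ m, w m * Real.exp (exponent M f opt η p w m))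

omit [Fintype 𝓜] [MeasurableSpace 𝓜] [MeasurableSingletonClass 𝓜] in
include hf hf01 in
lemma integrable_reward (p : Measure D) [IsProbabilityMeasure p] (m : 𝓜) :
    Integrable (f m) p :=
  Integrable.of_bound (hf m).aestronglyMeasurable 1 (Filter.Eventually.of_forall fun π => by
    rw [Real.norm_of_nonneg (hf01 m π).1]; exact (hf01 m π).2)

omit [MeasurableSpace 𝓜] [MeasurableSingletonClass 𝓜] in
include hM in
lemma integrable_hellMix (p : Measure D) [IsProbabilityMeasure p] {w : 𝓜 → ℝ} (hw : ∀ m, 0 ≤ w m)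
    (m : 𝓜) : Integrable (hellMix M m w) p :=
  Integrable.of_bound
    ((measurable_hellMix hM m).comp measurable_prodMk_left).aestronglyMeasurable
    (1 + ∑ m', w m') (Filter.Eventually.of_forall fun π => by
      rw [Real.norm_of_nonneg (hellMix_nonneg _ _ _ _)]; exact hellMix_le hM hw m π)

omit [MeasurableSpace 𝓜] [MeasurableSingletonClass 𝓜] in
include hM hf hf01 hopt hη in
-- The gap lies in `[0, 1]` and the Hellinger mean in `[0, 2]`; `-1` is a convenient weakening of
-- `-2/3`.
lemma exponent_mem (p : Measure D) [IsProbabilityMeasure p] {w : 𝓜 → ℝ} (hw : ∀ m, 0 ≤ w m)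
    (hw1 : ∑ m, w m ≤ 1) (m : 𝓜) : exponent M f opt η p w m ∈ Set.Icc (-1) η := by
  have h1 : 0 ≤ ∫ π, hellMix M m w π ∂p := integral_nonneg fun π => hellMix_nonneg _ _ _ _
  have h2 : ∫ π, hellMix M m w π ∂p ≤ 2 := by
    calc _ ≤ ∫ _, (2 : ℝ) ∂p := integral_mono (integrable_hellMix hM p hw m)
          (integrable_const _) fun π => (hellMix_le hM hw m π).trans (by linarith)
      _ = 2 := by simp
  have h3 : 0 ≤ ∫ π, f m π ∂p := integral_nonneg fun π => (hf01 m π).1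
  have h4 : ∫ π, f m π ∂p ≤ f m (opt m) := by
    calc _ ≤ ∫ _, f m (opt m) ∂p := integral_mono (integrable_reward hf hf01 p m)
          (integrable_const _) fun π => hopt m π
      _ = _ := by simp
  have h5 := (hf01 m (opt m)).2
  unfold exponent
  constructor <;> nlinarith

include hM hf hf01 hη in
-- The inner integral is `(exponent - K / 3) / η`. Its `μ`-mean follows from `K = E_μ[exponent] -
-- L`, which leaves `L + 2K/3`.
lemma roundTerm_eq (p : Measure D) [IsProbabilityMeasure p] (ρ : Measure 𝓜)
    [IsProbabilityMeasure ρ] :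
    roundTerm M f opt η p ρ = 1 / η * (logNormalizer M f opt η p (weights ρ) +
      2 / 3 * (klDiv (closedFormBelief M f opt η p ρ) ρ).toReal) := by
  have hkl := toReal_klDiv_tilted ρ (exponent M f opt η p (weights ρ))
  rw [← beliefExponent_eq hM] at hkl
  change (klDiv (closedFormBelief M f opt η p ρ) ρ).toReal =
    ∑ m, weights (closedFormBelief M f opt η p ρ) m * _ at hkl
  have : IsProbabilityMeasure (closedFormBelief M f opt η p ρ) :=
    isProbabilityMeasure_tilted_of_fintype ρ _
  unfold roundTerm
  rw [beliefExponent_eq hM] at hkl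
  change _ = ∑ m, _ * (_ - logNormalizer M f opt η p (weights ρ)) at hkl
  set K := (klDiv (closedFormBelief M f opt η p ρ) ρ).toReal
  set L := logNormalizer M f opt η p (weights ρ)
  set μ := closedFormBelief M f opt η p ρ
  have hsum : ∑ m, weights μ m = 1 := by rw [sum_weights]; simp
  have hin : ∀ m, ∫ π, (f m (opt m) - f m π - 1 / (3 * η) * hellingerSq (M m π) (inducedObs M ρ π)
      - 1 / (3 * η) * K) ∂p = 1 / η * (exponent M f opt η p (weights ρ) m - K / 3) := by
    intro m
    simp only [hellingerSq_inducedObs hM]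
    have i1 := integrable_reward hf hf01 p m
    have i2 := integrable_hellMix hM p (weights_nonneg ρ) m
    have i3 := ((integrable_const (f m (opt m))).sub i1).sub (i2.const_mul (1 / (3 * η)))
    have i4 := (integrable_const (f m (opt m))).sub i1
    simp only [Pi.sub_def] at i3 i4
    rw [integral_sub i3 (integrable_const _), integral_sub i4 (i2.const_mul _),
      integral_sub (integrable_const _) i1, integral_const_mul]
    simp only [integral_const, probReal_univ, one_smul, exponent]
    field_simp
  simp only [hin]
  rw [integral_eq_sum_weights]
  have e : ∑ m, weights μ m * (exponent M f opt η p (weights ρ) m - L) =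
      ∑ m, weights μ m * exponent M f opt η p (weights ρ) m - L := by
    simp only [mul_sub, Finset.sum_sub_distrib, ← Finset.sum_mul, hsum, one_mul]
  have e2 : ∑ m, weights μ m * (1 / η * (exponent M f opt η p (weights ρ) m - K / 3)) =
      1 / η * (∑ m, weights μ m * exponent M f opt η p (weights ρ) m - K / 3) := by
    simp only [mul_sub, Finset.sum_sub_distrib, ← Finset.sum_mul, hsum, one_mul, Finset.mul_sum]
    congr 1
    exact Finset.sum_congr rfl fun m _ => by ring
  rw [e2]
  rw [e] at hkl
  congr 1
  linarith

include hM in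
lemma toReal_klDiv_closedFormBelief (p : Measure D) (ρ : Measure 𝓜) [IsProbabilityMeasure ρ] :
    (klDiv (closedFormBelief M f opt η p ρ) ρ).toReal =
      ∑ m, weights (closedFormBelief M f opt η p ρ) m *
        (exponent M f opt η p (weights ρ) m - logNormalizer M f opt η p (weights ρ)) := by
  simp only [closedFormBelief, beliefExponent_eq hM]
  exact toReal_klDiv_tilted ρ (exponent M f opt η p (weights ρ))

include hM in
lemma weights_closedFormBelief (p : Measure D) (ρ : Measure 𝓜) [IsProbabilityMeasure ρ] (m : 𝓜) :
    weights (closedFormBelief M f opt η p ρ) m = weights ρ m * Real.exp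
      (exponent M f opt η p (weights ρ) m - logNormalizer M f opt η p (weights ρ)) := by
  rw [closedFormBelief, beliefExponent_eq hM, weights_tilted_eq_mul_exp]
  rfl

instance isProbabilityMeasure_closedFormBelief (p : Measure D) (ρ : Measure 𝓜)
    [IsProbabilityMeasure ρ] : IsProbabilityMeasure (closedFormBelief M f opt η p ρ) :=
  isProbabilityMeasure_tilted_of_fintype ρ _

instance isZeroOrProbabilityMeasure_closedFormBelief (p : Measure D) (ρ : Measure 𝓜) :
    IsZeroOrProbabilityMeasure (closedFormBelief M f opt η p ρ) :=
  isZeroOrProbabilityMeasure_tilted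

omit [Fintype 𝓜] [MeasurableSingletonClass 𝓜]
  [MeasurableSpace.CountableOrCountablyGenerated D O] in
-- A posterior with vanishing normalizer is the zero measure, so bounds over all histories must
-- include this case.
lemma roundTerm_zero (p : Measure D) : roundTerm M f opt η p 0 = 0 := by
  simp [roundTerm, closedFormBelief]

include hM hf hf01 hopt hη in
-- The log-normalizer lies in `[-1, η]` and the relative entropy in `[0, η + 1]`; the bound is
-- uniform over histories and yields integrability.
lemma abs_roundTerm_le (p : Measure D) [IsProbabilityMeasure p] (ρ : Measure 𝓜)
    [IsZeroOrProbabilityMeasure ρ] : |roundTerm M f opt η p ρ| ≤ 1 / η * (2 * (η + 1)) := by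
  rcases eq_zero_or_isProbabilityMeasure ρ with rfl | h
  · rw [roundTerm_zero, abs_zero]; positivity
  · have hE := exponent_mem hM hf hf01 hopt hη p (weights_nonneg ρ) (sum_weights_le_one ρ)
    have hL := log_sum_weights_mul_exp_mem ρ hE
    change logNormalizer M f opt η p (weights ρ) ∈ _ at hL
    have hK0 : 0 ≤ (klDiv (closedFormBelief M f opt η p ρ) ρ).toReal := ENNReal.toReal_nonneg
    have hK1 : (klDiv (closedFormBelief M f opt η p ρ) ρ).toReal ≤ η + 1 := by
      rw [toReal_klDiv_closedFormBelief hM]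
      calc _ ≤ ∑ m, weights (closedFormBelief M f opt η p ρ) m * (η + 1) :=
            Finset.sum_le_sum fun m _ => mul_le_mul_of_nonneg_left
              (by linarith [(hE m).2, hL.1]) (weights_nonneg _ m)
        _ = η + 1 := by rw [← Finset.sum_mul, sum_weights]; simp
    rw [roundTerm_eq hM hf hf01 hη, abs_mul, abs_of_pos (by positivity)]
    refine mul_le_mul_of_nonneg_left ?_ (by positivity)
    rw [abs_le]
    constructor <;> linarith [hL.1, hL.2]

include hM hf hf01 hη in
/-- The one-step inequality behind the regret bound, in terms of the log-weight of the true
model. -/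
lemma neg_log_weights_closedFormBelief_le (p : Measure D) [IsProbabilityMeasure p] (ρ : Measure 𝓜)
    [IsProbabilityMeasure ρ] (m : 𝓜) (hm : 0 < weights ρ m) :
    -Real.log (weights (closedFormBelief M f opt η p ρ) m) -
        ∫ π, hellMix M m (weights (closedFormBelief M f opt η p ρ)) π ∂p ≤
      -Real.log (weights ρ m) - η * (f m (opt m) - ∫ π, f m π ∂p) +
        η * roundTerm M f opt η p ρ := by
  rw [roundTerm_eq hM hf hf01 hη, ← mul_assoc, mul_one_div_cancel hη.ne', one_mul]
  have hw := weights_closedFormBelief (f := f) (opt := opt) (η := η) hM p ρ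
  have hK := toReal_klDiv_closedFormBelief (f := f) (opt := opt) (η := η) hM p ρ
  set K := (klDiv (closedFormBelief M f opt η p ρ) ρ).toReal
  set μ := closedFormBelief M f opt η p ρ with hμ
  set L := logNormalizer M f opt η p (weights ρ)
  have hDK : ∑ m', (√(weights μ m') - √(weights ρ m')) ^ 2 ≤ K := by
    rw [hK]
    exact sum_sq_sqrt_sub_sqrt_le _ (weights_nonneg ρ) hw (by rw [sum_weights]; simp)
      (by rw [sum_weights]; simp)
  have iμ := integrable_hellMix hM p (weights_nonneg μ) m
  have hH : ∫ π, hellMix M m (weights ρ) π ∂p ≤ 2 * ∫ π, hellMix M m (weights μ) π ∂p + 2 * K := by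
    calc _ ≤ ∫ π, (2 * hellMix M m (weights μ) π + 2 * K) ∂p := by
          refine integral_mono (integrable_hellMix hM p (weights_nonneg ρ) m)
            ((iμ.const_mul 2).add (integrable_const _)) fun π => ?_
          have := hellMix_le_two_mul hM (weights_nonneg μ) (weights_nonneg ρ) m π
          simp only
          linarith
      _ = _ := by
          rw [integral_add (iμ.const_mul 2) (integrable_const _), integral_const_mul]; simp
  have h0 : 0 ≤ ∫ π, hellMix M m (weights μ) π ∂p := integral_nonneg fun π => hellMix_nonneg _ _ _ _
  rw [hw m, Real.log_mul hm.ne' (Real.exp_pos _).ne', Real.log_exp, exponent]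
  -- A third of `hH` gives `2K/3`, matching the round term, plus two thirds of the Hellinger mean to
  -- `μ`; the available full copy absorbs the latter, and `h0` discards the rest.
  linarith

end Round

/-! ### The Bayesian update under the true model -/

section Posterior

variable {𝓜 D O : Type*} [Fintype 𝓜] [MeasurableSpace 𝓜] [MeasurableSingletonClass 𝓜]
  [MeasurableSpace D] [MeasurableSpace O] [MeasurableSpace.CountableOrCountablyGenerated D O]

lemma posteriorBelief_singleton (M : 𝓜 → Kernel D O) (μ : Measure 𝓜) (π : D) (o : O) (m : 𝓜) :
    posteriorBelief M μ π o {m} =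
      (∑ m', likelihood M m' π o * μ {m'})⁻¹ * (likelihood M m π o * μ {m}) := by
  rw [posteriorBelief, Measure.smul_apply, withDensity_apply _ (measurableSet_singleton m),
    lintegral_singleton, lintegral_fintype, smul_eq_mul]

instance isZeroOrProbabilityMeasure_posteriorBelief (M : 𝓜 → Kernel D O) (μ : Measure 𝓜)
    (π : D) (o : O) : IsZeroOrProbabilityMeasure (posteriorBelief M μ π o) := by
  refine ⟨?_⟩
  rw [posteriorBelief, Measure.smul_apply, withDensity_apply _ MeasurableSet.univ,
    setLIntegral_univ, smul_eq_mul]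
  -- Mass `Z⁻¹ * Z` is `0` both for `Z = 0` and for `Z = ∞`, by the conventions of `ℝ≥0∞`.
  rcases eq_or_ne (∫⁻ m, likelihood M m π o ∂μ) 0 with h0 | h0
  · simp [h0]
  rcases eq_or_ne (∫⁻ m, likelihood M m π o ∂μ) ∞ with h1 | h1
  · simp [h1]
  · exact Or.inr (ENNReal.inv_mul_cancel h0 h1)

/-- The square root of the ratio of the mixture density to the density of the model `m`. -/
def bayesRatio (M : 𝓜 → Kernel D O) (m : 𝓜) (w : 𝓜 → ℝ) (π : D) (o : O) : ℝ :=
  √(mixLik M w π o) * (√(lik M m π o))⁻¹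

omit [MeasurableSpace 𝓜] [MeasurableSingletonClass 𝓜] in
lemma bayesRatio_nonneg (M : 𝓜 → Kernel D O) (m : 𝓜) (w : 𝓜 → ℝ) (π : D) (o : O) :
    0 ≤ bayesRatio M m w π o := by unfold bayesRatio; positivity

omit [MeasurableSpace 𝓜] [MeasurableSingletonClass 𝓜] in
lemma measurable_bayesRatio (M : 𝓜 → Kernel D O) (m : 𝓜) :
    Measurable (fun x : (𝓜 → ℝ) × D × O => bayesRatio M m x.1 x.2.1 x.2.2) :=
  (measurable_mixLik M).sqrt.mul ((measurable_lik M m).comp measurable_snd).sqrt.inv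

variable {M : 𝓜 → Kernel D O} (hM : ∀ m, IsMarkovKernel (M m))
include hM

omit [MeasurableSpace 𝓜] [MeasurableSingletonClass 𝓜] in
-- Multiplying the ratio by the density of `M m` gives the affinity integrand, also where that
-- density vanishes, since the inverse of `0` is `0`.
lemma lintegral_bayesRatio (m : 𝓜) {w : 𝓜 → ℝ} (hw : ∀ m, 0 ≤ w m) (hw1 : ∑ m, w m = 1) (π : D) :
    ∫⁻ o, ENNReal.ofReal (bayesRatio M m w π o) ∂(M m π) =
      ENNReal.ofReal (1 - hellMix M m w π / 2) := by
  have hmeas : Measurable (bayesRatio M m w π) :=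
    (measurable_bayesRatio M m).comp (measurable_const.prodMk measurable_prodMk_left)
  rw [← withDensity_likelihood hM m π, lintegral_withDensity_eq_lintegral_mul _
    (measurable_likelihood_right M m π) hmeas.ennreal_ofReal, hellMix_eq hM hw, hw1]
  have e : 1 - (1 + 1 - 2 * ∫ o, √(lik M m π o) * √(mixLik M w π o) ∂(dominating M π)) / 2 =
      ∫ o, √(lik M m π o) * √(mixLik M w π o) ∂(dominating M π) := by ring
  rw [e, ofReal_integral_eq_lintegral_ofReal
    (integrable_sqrt_mul_sqrt (integrable_lik hM m π) (integrable_mixLik hM w π)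
      (lik_nonneg M m π) (mixLik_nonneg M hw π))
    (Filter.Eventually.of_forall fun o => by positivity)]
  refine lintegral_congr_ae ?_
  filter_upwards [likelihood_lt_top hM m π] with o ho
  have h1 : likelihood M m π o = ENNReal.ofReal (lik M m π o) := (ENNReal.ofReal_toReal ho.ne).symm
  simp only [Pi.mul_apply]
  rw [h1, ← ENNReal.ofReal_mul (lik_nonneg M m π o), bayesRatio]
  congr 1
  rcases (lik_nonneg M m π o).eq_or_lt with h | h
  · simp [← h]
  · have := (Real.sqrt_pos.2 h).ne'
    nth_rewrite 1 [← Real.sq_sqrt h.le]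
    field_simp

omit [MeasurableSpace 𝓜] [MeasurableSingletonClass 𝓜] in
lemma integral_bayesRatio (m : 𝓜) {w : 𝓜 → ℝ} (hw : ∀ m, 0 ≤ w m) (hw1 : ∑ m, w m = 1) (π : D) :
    ∫ o, bayesRatio M m w π o ∂(M m π) = 1 - hellMix M m w π / 2 := by
  have hmeas : Measurable (bayesRatio M m w π) :=
    (measurable_bayesRatio M m).comp (measurable_const.prodMk measurable_prodMk_left)
  rw [integral_eq_lintegral_of_nonneg_ae
    (Filter.Eventually.of_forall fun o => bayesRatio_nonneg M m w π o) hmeas.aestronglyMeasurable,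
    lintegral_bayesRatio hM m hw hw1, ENNReal.toReal_ofReal]
  have := hellMix_le hM hw m π
  rw [hw1] at this
  linarith

/-- Under the model `m`, the posterior keeps positive weight on `m`, and its log-weight is
controlled by `bayesRatio`. -/
lemma ae_weights_posteriorBelief (m : 𝓜) (μ : Measure 𝓜) [IsFiniteMeasure μ]
    (hm : 0 < weights μ m) (π : D) :
    ∀ᵐ o ∂(M m π), 0 < weights (posteriorBelief M μ π o) m ∧
      -Real.log (weights (posteriorBelief M μ π o) m) ≤
        -Real.log (weights μ m) - 2 + 2 * bayesRatio M m (weights μ) π o := by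
  -- Only observations with nonzero likelihood under `m` matter, so no logarithm of zero arises.
  rw [← withDensity_likelihood hM m π, ae_withDensity_iff (measurable_likelihood_right M m π)]
  filter_upwards [ae_all_iff.2 fun m' => likelihood_lt_top hM m' π] with o ho h0
  have hl : 0 < lik M m π o := ENNReal.toReal_pos h0 (ho m).ne
  have hmix : 0 < mixLik M (weights μ) π o :=
    (mul_pos hm hl).trans_le (Finset.single_le_sum (f := fun m => weights μ m * lik M m π o)
      (fun i _ => mul_nonneg (weights_nonneg μ i) (lik_nonneg M i π o)) (Finset.mem_univ m))
  have hpost : weights (posteriorBelief M μ π o) m =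
      weights μ m * (lik M m π o / mixLik M (weights μ) π o) := by
    rw [weights, Measure.real, posteriorBelief_singleton, ENNReal.toReal_mul, ENNReal.toReal_inv,
      ENNReal.toReal_sum fun m' _ => ENNReal.mul_ne_top (ho m').ne (measure_ne_top _ _)]
    simp only [ENNReal.toReal_mul]
    change (∑ m', lik M m' π o * weights μ m')⁻¹ * (lik M m π o * weights μ m) = _
    rw [mixLik, Finset.sum_congr rfl fun m' _ => mul_comm (lik M m' π o) (weights μ m'),
      div_eq_mul_inv]
    ring
  rw [hpost]
  refine ⟨by positivity, ?_⟩
  have hs1 := Real.sqrt_pos.2 hl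
  have hs2 := Real.sqrt_pos.2 hmix
  have hr : 0 < bayesRatio M m (weights μ) π o := mul_pos hs2 (inv_pos.2 hs1)
  have e : lik M m π o / mixLik M (weights μ) π o = (bayesRatio M m (weights μ) π o ^ 2)⁻¹ := by
    rw [bayesRatio, mul_pow, inv_pow, Real.sq_sqrt hl.le, Real.sq_sqrt hmix.le]
    field_simp
  rw [e, Real.log_mul hm.ne' (by positivity), Real.log_inv, Real.log_pow]
  -- The posterior factor is `r⁻²`, so its negative logarithm is `2 log r ≤ 2r - 2`.
  have := Real.log_le_sub_one_of_pos hr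
  push_cast
  linarith

end Posterior

/-! ### Measurable dependence on the history -/

section Measurability

variable {𝓜 D O H : Type*} [Fintype 𝓜] [MeasurableSpace 𝓜] [MeasurableSingletonClass 𝓜]
  [MeasurableSpace D] [MeasurableSpace O] [MeasurableSpace.CountableOrCountablyGenerated D O]
  [MeasurableSpace H] {M : 𝓜 → Kernel D O} (hM : ∀ m, IsMarkovKernel (M m))
  {f : 𝓜 → D → ℝ} (hf : ∀ m, Measurable (f m))
include hM hf

omit [MeasurableSpace 𝓜] [MeasurableSingletonClass 𝓜] in
lemma measurable_exponent (opt : 𝓜 → D) (η : ℝ) (κ : Kernel H D) [IsMarkovKernel κ]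
    {w : H → 𝓜 → ℝ} (hw : Measurable w) (m : 𝓜) :
    Measurable (fun h => exponent M f opt η (κ h) (w h) m) := by
  have h1 : Measurable (fun h => ∫ π, f m π ∂(κ h)) :=
    (((hf m).comp measurable_snd).stronglyMeasurable.integral_kernel_prod_right'
      (κ := κ)).measurable
  have h2 : Measurable (fun h => ∫ π, hellMix M m (w h) π ∂(κ h)) :=
    (((measurable_hellMix hM m).comp ((hw.comp measurable_fst).prodMk
      measurable_snd)).stronglyMeasurable.integral_kernel_prod_right' (κ := κ)).measurable
  exact ((measurable_const.sub h1).const_mul η).sub (h2.const_mul (1 / 3))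

omit [MeasurableSpace 𝓜] [MeasurableSingletonClass 𝓜] in
lemma measurable_logNormalizer (opt : 𝓜 → D) (η : ℝ) (κ : Kernel H D) [IsMarkovKernel κ]
    {w : H → 𝓜 → ℝ} (hw : Measurable w) :
    Measurable (fun h => logNormalizer M f opt η (κ h) (w h)) :=
  (Finset.measurable_fun_sum _ fun m _ => ((measurable_pi_apply m).comp hw).mul
    (measurable_exponent hM hf opt η κ hw m).exp).log

lemma measurable_weights_closedFormBelief (opt : 𝓜 → D) (η : ℝ) (κ : Kernel H D)
    [IsMarkovKernel κ] {ρ : H → Measure 𝓜} [∀ h, IsFiniteMeasure (ρ h)]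
    (hρ : Measurable fun h => weights (ρ h)) :
    Measurable (fun h => weights (closedFormBelief M f opt η (κ h) (ρ h))) := by
  have hE := measurable_exponent hM hf opt η κ hρ
  have hw : ∀ m, Measurable fun h => weights (ρ h) m := fun m => (measurable_pi_apply m).comp hρ
  refine measurable_pi_iff.2 fun m => ?_
  simp only [closedFormBelief, beliefExponent_eq hM, weights_tilted]
  exact (hw m).mul ((hE m).exp.div
    (Finset.measurable_fun_sum _ fun m' _ => (hw m').mul (hE m').exp))

lemma measurable_roundTerm (hf01 : ∀ m π, f m π ∈ Set.Icc (0 : ℝ) 1) (opt : 𝓜 → D) {η : ℝ}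
    (hη : 0 < η) (κ : Kernel H D) [IsMarkovKernel κ] {ρ : H → Measure 𝓜}
    [∀ h, IsZeroOrProbabilityMeasure (ρ h)] (hρ : Measurable fun h => weights (ρ h)) :
    Measurable (fun h => roundTerm M f opt η (κ h) (ρ h)) := by
  have e : ∀ h, roundTerm M f opt η (κ h) (ρ h) =
      1 / η * (logNormalizer M f opt η (κ h) (weights (ρ h)) +
        2 / 3 * ∑ m, weights (closedFormBelief M f opt η (κ h) (ρ h)) m *
          (exponent M f opt η (κ h) (weights (ρ h)) m -
            logNormalizer M f opt η (κ h) (weights (ρ h)))) := by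
    intro h
    -- The formula persists at `ρ h = 0`, where both sides vanish because `Real.log 0 = 0`.
    rcases eq_zero_or_isProbabilityMeasure (ρ h) with h0 | h1
    · simp [h0, roundTerm_zero, logNormalizer, closedFormBelief, weights]
    · rw [roundTerm_eq hM hf hf01 hη, toReal_klDiv_closedFormBelief hM]
  simp only [e]
  have hL := measurable_logNormalizer hM hf opt η κ hρ
  refine (hL.add ((Finset.measurable_fun_sum _ fun m _ => ?_).const_mul _)).const_mul _
  exact ((measurable_pi_apply m).comp
    (measurable_weights_closedFormBelief hM hf opt η κ hρ)).mul
    ((measurable_exponent hM hf opt η κ hρ m).sub hL)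

end Measurability

/-! ### The reference belief as a function of the history -/

section RefBelief

variable {𝓜 D O : Type*} [Fintype 𝓜] [MeasurableSpace 𝓜] [MeasurableSingletonClass 𝓜]
  [MeasurableSpace D] [MeasurableSpace O] [MeasurableSpace.CountableOrCountablyGenerated D O]
  {M : 𝓜 → Kernel D O} {f : 𝓜 → D → ℝ} {opt : 𝓜 → D} {η : ℝ}

instance isZeroOrProbabilityMeasure_refBelief (alg : Algorithm D O) (t : ℕ) (h : Fin t → D × O) :
    IsZeroOrProbabilityMeasure (refBelief M f opt η alg t h) := by
  cases t with
  | zero => simp only [refBelief, uniformOn]; infer_instance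
  | succ t => simp only [refBelief]; infer_instance

lemma measurable_finInit {X : Type*} [MeasurableSpace X] (t : ℕ) :
    Measurable (fun h : Fin (t + 1) → X => (Fin.init h : Fin t → X)) :=
  measurable_pi_iff.2 fun i => measurable_pi_apply i.castSucc

lemma measurable_weights_refBelief (hM : ∀ m, IsMarkovKernel (M m)) (hf : ∀ m, Measurable (f m))
    (alg : Algorithm D O) (t : ℕ) :
    Measurable (fun h => weights (refBelief M f opt η alg t h)) := by
  induction t with
  | zero => simp only [refBelief]; exact measurable_const
  | succ t ih =>
    have := alg.markov t
    have hμ : ∀ m, Measurable fun h : Fin (t + 1) → D × O =>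
        closedFormBelief M f opt η (alg.policy t (Fin.init h))
          (refBelief M f opt η alg t (Fin.init h)) {m} := by
      intro m
      have h1 := ((measurable_pi_apply m).comp
        (measurable_weights_closedFormBelief hM hf opt η (alg.policy t) ih)).ennreal_ofReal
      have h2 := h1.comp (measurable_finInit (X := D × O) t)
      convert h2 using 2 with h
      exact (ofReal_measureReal (h := measure_ne_top _ _)).symm
    have hl : ∀ m, Measurable fun h : Fin (t + 1) → D × O =>
        likelihood M m (h (Fin.last t)).1 (h (Fin.last t)).2 := fun m =>
      (measurable_likelihood M m).comp (measurable_pi_apply (Fin.last t))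
    refine measurable_pi_iff.2 fun m => ?_
    simp only [weights, Measure.real, refBelief, posteriorBelief_singleton]
    exact ((Finset.measurable_fun_sum _ fun m' _ => (hl m').mul (hμ m')).inv.mul
      ((hl m).mul (hμ m))).ennreal_toReal

end RefBelief

/-! ### The law of the history and its marginals -/

section History

variable {D O : Type*} [MeasurableSpace D] [MeasurableSpace O]

/-- The law of the next (decision, observation) pair given the history. -/
abbrev stepKernel (alg : Algorithm D O) (env : Kernel D O) (t : ℕ) :
    Kernel (Fin t → D × O) (D × O) :=
  alg.policy t ⊗ₖ Kernel.prodMkLeft (Fin t → D × O) env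

instance isMarkovKernel_policy (alg : Algorithm D O) (t : ℕ) : IsMarkovKernel (alg.policy t) :=
  alg.markov t

/-- Appending a new pair to the history. -/
def appendStep (t : ℕ) (x : (Fin t → D × O) × D × O) : Fin (t + 1) → D × O :=
  Fin.snoc (α := fun _ => D × O) x.1 x.2

lemma measurable_appendStep (t : ℕ) : Measurable (appendStep (D := D) (O := O) t) := by
  refine measurable_pi_iff.2 fun i => ?_
  induction i using Fin.lastCases with
  | last => simpa [appendStep] using measurable_snd
  | cast i =>
    simp only [appendStep, Fin.snoc_castSucc]
    exact (measurable_pi_apply i).comp measurable_fst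

omit [MeasurableSpace D] [MeasurableSpace O] in
@[simp]
lemma init_appendStep (t : ℕ) (x : (Fin t → D × O) × D × O) :
    (Fin.init (appendStep t x) : Fin t → D × O) = x.1 := by
  simp [appendStep]

omit [MeasurableSpace D] [MeasurableSpace O] in
@[simp]
lemma appendStep_last (t : ℕ) (x : (Fin t → D × O) × D × O) :
    appendStep t x (Fin.last t) = x.2 := by
  simp [appendStep]

lemma historyLaw_succ (alg : Algorithm D O) (env : Kernel D O) (t : ℕ) :
    historyLaw alg env (t + 1) =
      (historyLaw alg env t ⊗ₘ stepKernel alg env t).map (appendStep t) := rfl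

variable (alg : Algorithm D O) (env : Kernel D O) [IsMarkovKernel env]

instance isProbabilityMeasure_historyLaw (t : ℕ) :
    IsProbabilityMeasure (historyLaw alg env t) := by
  induction t with
  | zero => rw [historyLaw]; infer_instance
  | succ t ih =>
    rw [historyLaw_succ]
    exact Measure.isProbabilityMeasure_map (measurable_appendStep t).aemeasurable

lemma map_init_historyLaw (t : ℕ) :
    (historyLaw alg env (t + 1)).map (fun h => (Fin.init h : Fin t → D × O)) =
      historyLaw alg env t := by
  rw [historyLaw_succ, Measure.map_map (measurable_finInit t) (measurable_appendStep t)]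
  have e : (fun h : Fin (t + 1) → D × O => (Fin.init h : Fin t → D × O)) ∘ appendStep t =
      Prod.fst := by ext1 x; simp
  rw [e]
  exact Measure.fst_compProd _ _

lemma integral_init_historyLaw (t : ℕ) {g : (Fin t → D × O) → ℝ} (hg : Measurable g) :
    ∫ h, g (Fin.init h) ∂(historyLaw alg env (t + 1)) = ∫ h, g h ∂(historyLaw alg env t) := by
  conv_rhs => rw [← map_init_historyLaw alg env t]
  rw [integral_map (measurable_finInit t).aemeasurable hg.aestronglyMeasurable]

lemma integral_last_decision (t : ℕ) {g : D → ℝ} (hg : Measurable g) {C : ℝ}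
    (hC : ∀ π, |g π| ≤ C) :
    ∫ h, g (h (Fin.last t)).1 ∂(historyLaw alg env (t + 1)) =
      ∫ h, ∫ π, g π ∂(alg.policy t h) ∂(historyLaw alg env t) := by
  have hm : Measurable fun h : Fin (t + 1) → D × O => g (h (Fin.last t)).1 :=
    hg.comp (measurable_fst.comp (measurable_pi_apply _))
  rw [historyLaw_succ, integral_map (measurable_appendStep t).aemeasurable hm.aestronglyMeasurable]
  simp only [appendStep_last]
  have hm2 : Measurable fun x : (Fin t → D × O) × D × O => g x.2.1 :=
    hg.comp (measurable_fst.comp measurable_snd)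
  rw [Measure.integral_compProd (Integrable.of_bound hm2.aestronglyMeasurable C
    (Filter.Eventually.of_forall fun x => hC _))]
  refine integral_congr_ae (Filter.Eventually.of_forall fun h => ?_)
  simp only
  rw [integral_compProd (f := fun x : D × O => g x.1)
    (Integrable.of_bound (hg.comp measurable_fst).aestronglyMeasurable C
    (Filter.Eventually.of_forall fun x => hC _))]
  simp

end History

/-! ### Drift of the potential and telescoping -/

section Regret

variable {𝓜 D O : Type*} [Fintype 𝓜] [MeasurableSpace 𝓜] [MeasurableSingletonClass 𝓜]
  [MeasurableSpace D] [MeasurableSpace O] [MeasurableSpace.CountableOrCountablyGenerated D O]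
  {M : 𝓜 → Kernel D O} [hM : ∀ m, IsMarkovKernel (M m)] {f : 𝓜 → D → ℝ}
  (hf : ∀ m, Measurable (f m)) (hf01 : ∀ m π, f m π ∈ Set.Icc (0 : ℝ) 1) {opt : 𝓜 → D}
  (hopt : ∀ m π, f m π ≤ f m (opt m)) {η : ℝ} (hη : 0 < η) (alg : Algorithm D O) (m : 𝓜)

omit [MeasurableSpace 𝓜] [MeasurableSingletonClass 𝓜] in
include hM in
-- This bound supplies the integrability of the ratio, which computing its Bochner integral
-- presupposes.
lemma lintegral_bayesRatio_stepKernel_le_one (t : ℕ) (h : Fin t → D × O) (w : 𝓜 → ℝ)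
    (hw : ∀ m, 0 ≤ w m) (hw1 : ∑ m, w m = 1) :
    ∫⁻ x, ENNReal.ofReal (bayesRatio M m w x.1 x.2) ∂(stepKernel alg (M m) t h) ≤ 1 := by
  have hG : Measurable fun x : D × O => bayesRatio M m w x.1 x.2 :=
    (measurable_bayesRatio M m).comp measurable_prodMk_left
  rw [Kernel.lintegral_compProd _ _ _ hG.ennreal_ofReal]
  simp only [Kernel.prodMkLeft_apply, lintegral_bayesRatio hM m hw hw1]
  calc ∫⁻ π, ENNReal.ofReal (1 - hellMix M m w π / 2) ∂(alg.policy t h)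
      ≤ ∫⁻ _, 1 ∂(alg.policy t h) := by
        refine lintegral_mono fun π => ?_
        rw [ENNReal.ofReal_le_one]
        linarith [hellMix_nonneg M w m π]
    _ = 1 := by simp

omit [MeasurableSpace 𝓜] [MeasurableSingletonClass 𝓜] in
include hM in
lemma integral_bayesRatio_stepKernel (t : ℕ) (h : Fin t → D × O) (w : 𝓜 → ℝ)
    (hw : ∀ m, 0 ≤ w m) (hw1 : ∑ m, w m = 1)
    (hi : Integrable (fun x : D × O => bayesRatio M m w x.1 x.2) (stepKernel alg (M m) t h)) :
    ∫ x, bayesRatio M m w x.1 x.2 ∂(stepKernel alg (M m) t h) =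
      1 - (∫ π, hellMix M m w π ∂(alg.policy t h)) / 2 := by
  rw [integral_compProd hi]
  simp only [Kernel.prodMkLeft_apply, integral_bayesRatio hM m hw hw1]
  rw [integral_sub (integrable_const _) ((integrable_hellMix hM _ hw m).div_const 2), integral_div]
  simp

include hM hf

lemma ae_weights_refBelief_step (t : ℕ) (h : Fin t → D × O)
    (hpos : 0 < weights (refBelief M f opt η alg t h) m) :
    ∀ᵐ x ∂(stepKernel alg (M m) t h),
      0 < weights (refBelief M f opt η alg (t + 1) (appendStep t (h, x))) m ∧
      -Real.log (weights (refBelief M f opt η alg (t + 1) (appendStep t (h, x))) m) ≤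
        -Real.log (weights (algBelief M f opt η alg t h) m) - 2 +
          2 * bayesRatio M m (weights (algBelief M f opt η alg t h)) x.1 x.2 := by
  have hw := ((measurable_pi_apply m).comp
    (measurable_weights_refBelief (opt := opt) (η := η) hM hf alg (t + 1))).comp
      ((measurable_appendStep t).comp (measurable_prodMk_left (x := h)))
  have hb : Measurable fun x : D × O =>
      bayesRatio M m (weights (algBelief M f opt η alg t h)) x.1 x.2 :=
    (measurable_bayesRatio M m).comp measurable_prodMk_left
  refine Kernel.ae_compProd_of_ae_ae ((measurableSet_lt measurable_const hw).inter
    (measurableSet_le hw.log.neg ((hb.const_mul 2).const_add _))) ?_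
  refine Filter.Eventually.of_forall fun π => ?_
  -- One positive weight excludes the zero measure.
  have hρ : IsProbabilityMeasure (refBelief M f opt η alg t h) := by
    rcases eq_zero_or_isProbabilityMeasure (refBelief M f opt η alg t h) with h0 | h1
    · simp [h0, weights] at hpos
    · exact h1
  have hμ : 0 < weights (algBelief M f opt η alg t h) m := by
    rw [algBelief, weights_closedFormBelief hM]
    positivity
  have : IsFiniteMeasure (algBelief M f opt η alg t h) := by
    unfold algBelief; infer_instance
  rw [Kernel.prodMkLeft_apply]
  filter_upwards [ae_weights_posteriorBelief hM m (algBelief M f opt η alg t h) hμ π] with o ho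
  simp only [refBelief, init_appendStep, appendStep_last]
  exact ho

/-- Tilting multiplies weights by positive factors, and data drawn from `M m` almost surely have
positive likelihood under `m`. -/
lemma ae_weights_refBelief_pos (t : ℕ) :
    ∀ᵐ h ∂(historyLaw alg (M m) t), 0 < weights (refBelief M f opt η alg t h) m := by
  induction t with
  | zero =>
    refine Filter.Eventually.of_forall fun h => ?_
    have : Nonempty 𝓜 := ⟨m⟩
    simp only [refBelief, weights, Measure.real, uniformOn_univ]
    simp [Fintype.card_pos]
  | succ t ih =>
    have hw : Measurable fun h => weights (refBelief M f opt η alg (t + 1) h) m :=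
      (measurable_pi_apply m).comp (measurable_weights_refBelief hM hf alg (t + 1))
    have hset := measurableSet_lt (measurable_const (a := (0 : ℝ))) hw
    rw [historyLaw_succ, ae_map_iff (measurable_appendStep t).aemeasurable hset]
    refine Measure.ae_compProd_of_ae_ae (measurable_appendStep t hset) ?_
    filter_upwards [ih] with h hh
    filter_upwards [ae_weights_refBelief_step hf alg m t h hh] with x hx using hx.1

omit hM [Fintype 𝓜] [MeasurableSpace 𝓜] [MeasurableSingletonClass 𝓜]
  [MeasurableSpace.CountableOrCountablyGenerated D O] in
include hf01 hopt in
lemma integrable_expected_gap (t : ℕ) (P : Measure (Fin t → D × O)) [IsFiniteMeasure P] :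
    Integrable (fun h => f m (opt m) - ∫ π, f m π ∂(alg.policy t h)) P := by
  have hfm : Measurable (fun h => ∫ π, f m π ∂(alg.policy t h)) :=
    (((hf m).comp measurable_snd).stronglyMeasurable.integral_kernel_prod_right'
      (κ := alg.policy t)).measurable
  refine Integrable.of_bound (measurable_const.sub hfm).aestronglyMeasurable 1
    (Filter.Eventually.of_forall fun h => ?_)
  have h3 : 0 ≤ ∫ π, f m π ∂(alg.policy t h) := integral_nonneg fun π => (hf01 m π).1
  have h4 : ∫ π, f m π ∂(alg.policy t h) ≤ f m (opt m) := by
    calc _ ≤ ∫ _, f m (opt m) ∂(alg.policy t h) := integral_mono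
          (integrable_reward hf hf01 _ m) (integrable_const _) fun π => hopt m π
      _ = _ := by simp
  rw [Real.norm_eq_abs, abs_le]
  constructor <;> linarith [(hf01 m (opt m)).2]

include hf01 hopt hη

/-- One round: integrability and expected drift of the negative log-weight of the true model. -/
lemma integral_neg_log_weights_refBelief_succ_le (t : ℕ)
    (hint : Integrable (fun h => -Real.log (weights (refBelief M f opt η alg t h) m))
      (historyLaw alg (M m) t)) :
    Integrable (fun h => -Real.log (weights (refBelief M f opt η alg (t + 1) h) m))
      (historyLaw alg (M m) (t + 1)) ∧
    ∫ h, -Real.log (weights (refBelief M f opt η alg (t + 1) h) m)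
        ∂(historyLaw alg (M m) (t + 1)) ≤
      ∫ h, (-Real.log (weights (refBelief M f opt η alg t h) m)
        - η * (f m (opt m) - ∫ π, f m π ∂(alg.policy t h))
        + η * roundTerm M f opt η (alg.policy t h) (refBelief M f opt η alg t h))
        ∂(historyLaw alg (M m) t) := by
  set P := historyLaw alg (M m) t with hP
  set κ := stepKernel alg (M m) t with hκ
  have hρm := measurable_weights_refBelief (opt := opt) (η := η) hM hf alg t
  have hμm := measurable_weights_closedFormBelief hM hf opt η (alg.policy t) hρm
  have hμ : ∀ᵐ h ∂P, IsProbabilityMeasure (refBelief M f opt η alg t h) ∧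
      IsProbabilityMeasure (algBelief M f opt η alg t h) ∧
      0 < weights (refBelief M f opt η alg t h) m := by
    filter_upwards [ae_weights_refBelief_pos (opt := opt) (η := η) hf alg m t] with h hh
    rcases eq_zero_or_isProbabilityMeasure (refBelief M f opt η alg t h) with h0 | h1
    · simp [h0, weights] at hh
    · exact ⟨h1, isProbabilityMeasure_closedFormBelief _ _, hh⟩
  have hroundm := measurable_roundTerm hM hf hf01 opt hη (alg.policy t) hρm
  -- integrability of the log-weight of the algorithmic belief
  have hlogμ : Integrable (fun h => -Real.log (weights (algBelief M f opt η alg t h) m)) P := by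
    have hb : Integrable (fun h => exponent M f opt η (alg.policy t h)
        (weights (refBelief M f opt η alg t h)) m - logNormalizer M f opt η (alg.policy t h)
        (weights (refBelief M f opt η alg t h))) P := by
      refine Integrable.of_bound ((measurable_exponent hM hf opt η _ hρm m).sub
        (measurable_logNormalizer hM hf opt η _ hρm)).aestronglyMeasurable (η + 1) ?_
      filter_upwards [hμ] with h hh
      have := hh.1
      have hE := exponent_mem hM hf hf01 hopt hη (alg.policy t h)
        (weights_nonneg (refBelief M f opt η alg t h))
        (sum_weights_le_one (refBelief M f opt η alg t h))
      have hL := log_sum_weights_mul_exp_mem (refBelief M f opt η alg t h) hE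
      rw [Real.norm_eq_abs, abs_le, logNormalizer]
      constructor <;> linarith [(hE m).1, (hE m).2, hL.1, hL.2]
    refine (hint.sub hb).congr ?_
    filter_upwards [hμ] with h hh
    have := hh.1
    rw [algBelief, weights_closedFormBelief hM,
      Real.log_mul hh.2.2.ne' (Real.exp_pos _).ne', Real.log_exp]
    simp only [Pi.sub_apply]
    ring
  -- integrability of the likelihood ratio
  have hGm : Measurable fun x : (Fin t → D × O) × D × O =>
      bayesRatio M m (weights (algBelief M f opt η alg t x.1)) x.2.1 x.2.2 :=
    (measurable_bayesRatio M m).comp ((hμm.comp measurable_fst).prodMk measurable_snd)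
  have hG : Integrable (fun x : (Fin t → D × O) × D × O =>
      bayesRatio M m (weights (algBelief M f opt η alg t x.1)) x.2.1 x.2.2) (P ⊗ₘ κ) := by
    refine ⟨hGm.aestronglyMeasurable, ?_⟩
    rw [hasFiniteIntegral_iff_ofReal
      (Filter.Eventually.of_forall fun x => bayesRatio_nonneg M m _ _ _),
      Measure.lintegral_compProd hGm.ennreal_ofReal]
    refine lt_of_le_of_lt (lintegral_mono_ae (g := fun _ => 1) ?_) (by simp)
    filter_upwards [hμ] with h hh
    have := hh.2.1
    exact lintegral_bayesRatio_stepKernel_le_one alg m t h _ (weights_nonneg _)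
      (by rw [sum_weights]; simp)
  have hU : Integrable (fun x : (Fin t → D × O) × D × O =>
      -Real.log (weights (algBelief M f opt η alg t x.1) m) - 2 +
        2 * bayesRatio M m (weights (algBelief M f opt η alg t x.1)) x.2.1 x.2.2) (P ⊗ₘ κ) := by
    refine Integrable.add (Integrable.sub ?_ (integrable_const _)) (hG.const_mul 2)
    have hfst : P = (P ⊗ₘ κ).map Prod.fst := (Measure.fst_compProd P κ).symm
    rw [hfst] at hlogμ
    exact hlogμ.comp_measurable measurable_fst
  have hw : Measurable fun h => -Real.log (weights (refBelief M f opt η alg (t + 1) h) m) :=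
    ((measurable_pi_apply m).comp (measurable_weights_refBelief hM hf alg (t + 1))).log.neg
  have hstepm := hw.comp (measurable_appendStep t)
  have hle : ∀ᵐ x ∂(P ⊗ₘ κ),
      -Real.log (weights (refBelief M f opt η alg (t + 1) (appendStep t x)) m) ≤
        -Real.log (weights (algBelief M f opt η alg t x.1) m) - 2 +
          2 * bayesRatio M m (weights (algBelief M f opt η alg t x.1)) x.2.1 x.2.2 := by
    refine Measure.ae_compProd_of_ae_ae (measurableSet_le hstepm
      ((((((measurable_pi_apply m).comp hμm).log.neg).comp measurable_fst).sub_const 2).add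
        (hGm.const_mul 2))) ?_
    filter_upwards [hμ] with h hh
    filter_upwards [ae_weights_refBelief_step hf alg m t h hh.2.2] with x hx using hx.2
  have hnn : ∀ x, 0 ≤ -Real.log (weights (refBelief M f opt η alg (t + 1) (appendStep t x)) m) :=
    fun x => neg_nonneg.2 (Real.log_nonpos (weights_nonneg _ _) measureReal_le_one)
  -- The new negative log-weight is squeezed between `0` and the integrable bound `hU`.
  have hΦ : Integrable
      (fun x => -Real.log (weights (refBelief M f opt η alg (t + 1) (appendStep t x)) m))
      (P ⊗ₘ κ) := by
    refine hU.mono' hstepm.aestronglyMeasurable ?_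
    filter_upwards [hle] with x hx
    rwa [Real.norm_of_nonneg (hnn x)]
  refine ⟨?_, ?_⟩
  · rw [historyLaw_succ]
    exact (integrable_map_measure hw.aestronglyMeasurable
      (measurable_appendStep t).aemeasurable).2 hΦ
  rw [historyLaw_succ, integral_map (measurable_appendStep t).aemeasurable
    hw.aestronglyMeasurable]
  refine (integral_mono_ae hΦ hU hle).trans ?_
  rw [Measure.integral_compProd hU]
  -- `P` is viewed as a constant kernel on `Unit` to use the kernel form of Fubini integrability.
  have hUint := Integrable.integral_compProd (κ := Kernel.const Unit P)
    (η := Kernel.prodMkLeft Unit κ) (a := ()) hU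
  simp only [Kernel.const_apply, Kernel.prodMkLeft_apply] at hUint
  refine integral_mono_ae hUint ?_ ?_
  · exact (hint.sub ((integrable_expected_gap hf hf01 hopt alg m t P).const_mul η)).add
      ((Integrable.of_bound hroundm.aestronglyMeasurable (1 / η * (2 * (η + 1)))
        (Filter.Eventually.of_forall fun h =>
          abs_roundTerm_le hM hf hf01 hopt hη (alg.policy t h) _)).const_mul η)
  · filter_upwards [hμ, (Measure.integrable_compProd_iff hU.1).1 hU |>.1,
      (Measure.integrable_compProd_iff hG.1).1 hG |>.1] with h hh hUi hGi
    have := hh.1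
    have := hh.2.1
    -- Averaging the ratio turns `-2 + 2r` into `-2 + 2 (1 - H/2) = -H`, the Hellinger term of the
    -- one-step inequality.
    refine le_trans (le_of_eq ?_) (neg_log_weights_closedFormBelief_le hM hf hf01 hη
      (alg.policy t h) (refBelief M f opt η alg t h) m hh.2.2)
    rw [integral_add (integrable_const _) (hGi.const_mul 2), integral_const_mul,
      integral_bayesRatio_stepKernel alg m t h _ (weights_nonneg _)
        (by rw [sum_weights]; simp) hGi]
    simp only [integral_const, probReal_univ, one_smul, algBelief]
    ring

/-- The sum over rounds of the regret terms telescopes against the log-weight of the true model. -/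
lemma regret_add_integral_neg_log_le (T : ℕ) :
    Integrable (fun h => -Real.log (weights (refBelief M f opt η alg T h) m))
      (historyLaw alg (M m) T) ∧
    η * ∫ h, ∑ t : Fin T, (f m (opt m) - f m (h t).1) ∂(historyLaw alg (M m) T) +
      ∫ h, -Real.log (weights (refBelief M f opt η alg T h) m) ∂(historyLaw alg (M m) T) ≤
    Real.log (Fintype.card 𝓜) + η * ∫ h, ∑ t : Fin T,
      roundTerm M f opt η (alg.policy t fun i => h (Fin.castLE t.2.le i))
        (refBelief M f opt η alg t fun i => h (Fin.castLE t.2.le i))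
      ∂(historyLaw alg (M m) T) := by
  induction T with
  | zero =>
    have e : ∀ h : Fin 0 → D × O, -Real.log (weights (refBelief M f opt η alg 0 h) m) =
        Real.log (Fintype.card 𝓜) := by
      intro h
      simp [refBelief, weights, Measure.real, uniformOn_univ]
    simp only [e]
    exact ⟨integrable_const _, by simp⟩
  | succ T ih =>
    obtain ⟨hint, hle⟩ := ih
    obtain ⟨hint', hle'⟩ :=
      integral_neg_log_weights_refBelief_succ_le hf hf01 hopt hη alg m T hint
    refine ⟨hint', ?_⟩
    have hfabs : ∀ π, |f m (opt m) - f m π| ≤ 1 := fun π => by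
      rw [abs_le]
      constructor <;> linarith [(hf01 m π).1, (hf01 m π).2, hopt m π, (hf01 m (opt m)).2]
    have hround : ∀ t (N : ℕ) (hN : t ≤ N), Measurable fun h : Fin N → D × O =>
        roundTerm M f opt η (alg.policy t fun i => h (Fin.castLE hN i))
          (refBelief M f opt η alg t fun i => h (Fin.castLE hN i)) := fun t N hN =>
      (measurable_roundTerm hM hf hf01 opt hη (alg.policy t)
        (measurable_weights_refBelief hM hf alg t)).comp
        (measurable_pi_iff.2 fun i => measurable_pi_apply (Fin.castLE hN i))
    have hroundi : ∀ t (N : ℕ) (hN : t ≤ N), Integrable (fun h : Fin N → D × O =>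
        roundTerm M f opt η (alg.policy t fun i => h (Fin.castLE hN i))
          (refBelief M f opt η alg t fun i => h (Fin.castLE hN i))) (historyLaw alg (M m) N) :=
      fun t N hN => Integrable.of_bound (hround t N hN).aestronglyMeasurable
        (1 / η * (2 * (η + 1))) (Filter.Eventually.of_forall fun h =>
          abs_roundTerm_le hM hf hf01 hopt hη _ _)
    have hrewm : ∀ (N : ℕ) (t : Fin N), Measurable fun h : Fin N → D × O =>
        f m (opt m) - f m (h t).1 := fun N t =>
      measurable_const.sub ((hf m).comp (measurable_fst.comp (measurable_pi_apply t)))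
    have hrewi : ∀ (N : ℕ) (t : Fin N), Integrable (fun h : Fin N → D × O =>
        f m (opt m) - f m (h t).1) (historyLaw alg (M m) N) := fun N t =>
      Integrable.of_bound (hrewm N t).aestronglyMeasurable 1
        (Filter.Eventually.of_forall fun h => hfabs _)
    -- The last reward is averaged over `p_T`, matching the one-step drift; earlier rounds depend
    -- only on the initial segment.
    have eA : ∫ h, ∑ t : Fin (T + 1), (f m (opt m) - f m (h t).1)
          ∂(historyLaw alg (M m) (T + 1)) =
        ∫ h, ∑ t : Fin T, (f m (opt m) - f m (h t).1) ∂(historyLaw alg (M m) T) +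
        ∫ h, (f m (opt m) - ∫ π, f m π ∂(alg.policy T h)) ∂(historyLaw alg (M m) T) := by
      simp only [Fin.sum_univ_castSucc]
      rw [integral_add (integrable_finsetSum _ fun t _ => hrewi _ _) (hrewi _ _),
        integral_last_decision alg (M m) T (g := fun π => f m (opt m) - f m π)
          (measurable_const.sub (hf m)) hfabs]
      congr 1
      · exact integral_init_historyLaw alg (M m) T
          (g := fun h => ∑ t : Fin T, (f m (opt m) - f m (h t).1))
          (Finset.measurable_fun_sum _ fun t _ => hrewm _ _)
      · refine integral_congr_ae (Filter.Eventually.of_forall fun h => ?_)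
        simp only
        rw [integral_sub (integrable_const _) (integrable_reward hf hf01 _ m)]
        simp
    have eB : ∫ h, ∑ t : Fin (T + 1),
          roundTerm M f opt η (alg.policy t fun i => h (Fin.castLE t.2.le i))
            (refBelief M f opt η alg t fun i => h (Fin.castLE t.2.le i))
          ∂(historyLaw alg (M m) (T + 1)) =
        ∫ h, ∑ t : Fin T, roundTerm M f opt η (alg.policy t fun i => h (Fin.castLE t.2.le i))
            (refBelief M f opt η alg t fun i => h (Fin.castLE t.2.le i))
          ∂(historyLaw alg (M m) T) +
        ∫ h, roundTerm M f opt η (alg.policy T h) (refBelief M f opt η alg T h)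
          ∂(historyLaw alg (M m) T) := by
      simp only [Fin.sum_univ_castSucc]
      rw [integral_add (integrable_finsetSum _ fun t _ => hroundi _ _ _) (hroundi _ _ _)]
      congr 1
      · exact integral_init_historyLaw alg (M m) T
          (g := fun h => ∑ t : Fin T,
            roundTerm M f opt η (alg.policy t fun i => h (Fin.castLE t.2.le i))
              (refBelief M f opt η alg t fun i => h (Fin.castLE t.2.le i)))
          (Finset.measurable_fun_sum _ fun t _ => hround _ _ _)
      · exact integral_init_historyLaw alg (M m) T
          (g := fun h => roundTerm M f opt η (alg.policy T h) (refBelief M f opt η alg T h))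
          (hround T T le_rfl)
    have hri := integrable_expected_gap hf hf01 hopt alg m T (historyLaw alg (M m) T)
    have hsub := hint.sub (hri.const_mul η)
    rw [Pi.sub_def] at hsub
    have hlast : Integrable (fun h => roundTerm M f opt η (alg.policy T h)
      (refBelief M f opt η alg T h)) (historyLaw alg (M m) T) := hroundi T T le_rfl
    rw [integral_add hsub (hlast.const_mul η), integral_sub hint (hri.const_mul η), integral_const_mul, integral_const_mul] at hle'
    rw [eA, eB]
    linarith

end Regret

end

end DMSO

/-! ### The regret bound -/

theorem theorem7p3 {𝓜 D O : Type*} [Fintype 𝓜] [MeasurableSpace 𝓜] [MeasurableSingletonClass 𝓜]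
    [MeasurableSpace D] [MeasurableSpace O] [MeasurableSpace.CountableOrCountablyGenerated D O]
    (M : 𝓜 → Kernel D O) (hM : ∀ m, IsMarkovKernel (M m))
    (f : 𝓜 → D → ℝ) (hf : ∀ m, Measurable (f m)) (hf01 : ∀ m π, f m π ∈ Set.Icc (0 : ℝ) 1)
    (opt : 𝓜 → D) (hopt : ∀ m π, f m π ≤ f m (opt m))
    (alg : DMSO.Algorithm D O) (η : ℝ) (hη : 0 < η) (Mstar : 𝓜) (T : ℕ) :
    DMSO.regret alg (M Mstar) (f Mstar) T ≤
      Real.log (Fintype.card 𝓜) / η +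
        ∫ h, ∑ t : Fin T,
          (let past : Fin t → D × O := fun i => h (Fin.castLE t.2.le i)
           let p := alg.policy t past
           let ρ := DMSO.refBelief M f opt η alg t past
           let μ := DMSO.algBelief M f opt η alg t past
           ∫ m, ∫ π, (f m (opt m) - f m π
              - 1 / (3 * η) * DMSO.hellingerSq (M m π) (DMSO.inducedObs M ρ π)
              - 1 / (3 * η) * (klDiv μ ρ).toReal) ∂p ∂μ)
          ∂(DMSO.historyLaw alg (M Mstar) T) := by
  have : Nonempty D := ⟨opt Mstar⟩
  obtain ⟨-, hmain⟩ := DMSO.regret_add_integral_neg_log_le (M := M) hf hf01 hopt hη alg Mstar T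
  have hnn : 0 ≤ ∫ h, -Real.log (DMSO.weights (DMSO.refBelief M f opt η alg T h) Mstar)
      ∂(DMSO.historyLaw alg (M Mstar) T) := integral_nonneg fun h =>
    neg_nonneg.2 (Real.log_nonpos (DMSO.weights_nonneg _ _) measureReal_le_one)
  have hmain' : ∫ h, ∑ t : Fin T, (f Mstar (opt Mstar) - f Mstar (h t).1)
      ∂(DMSO.historyLaw alg (M Mstar) T) ≤ Real.log (Fintype.card 𝓜) / η +
        ∫ h, ∑ t : Fin T,
          DMSO.roundTerm M f opt η (alg.policy t fun i => h (Fin.castLE t.2.le i))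
            (DMSO.refBelief M f opt η alg t fun i => h (Fin.castLE t.2.le i))
          ∂(DMSO.historyLaw alg (M Mstar) T) := by
    rw [← mul_le_mul_iff_of_pos_left hη, mul_add, mul_div_cancel₀ _ hη.ne']
    linarith
  -- No comparator beats `opt Mstar`, even pointwise along the history; `ciSup_le` uses only that
  -- decisions exist.
  refine le_trans (ciSup_le fun πstar => ?_) hmain'
  have hi : ∀ c : ℝ, ∀ t : Fin T, Integrable (fun h : Fin T → D × O => c - f Mstar (h t).1)
      (DMSO.historyLaw alg (M Mstar) T) := fun c t =>
    (integrable_const c).sub (Integrable.of_bound ((hf Mstar).comp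
      (measurable_fst.comp (measurable_pi_apply t))).aestronglyMeasurable 1
      (Filter.Eventually.of_forall fun h => by
        rw [Real.norm_of_nonneg (hf01 Mstar _).1]; exact (hf01 Mstar _).2))
  simp only [← Finset.sum_sub_distrib]
  exact integral_mono (integrable_finsetSum _ fun t _ => hi _ t)
    (integrable_finsetSum _ fun t _ => hi _ t) fun h =>
    Finset.sum_le_sum fun t _ => sub_le_sub_right (hopt Mstar πstar) _
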